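/- **Setting.** Let $K$ be an algebraically closed field of characteristic $0$, and let $A\subset\mathbb Z^d$ be a finite set with $\mathbb ZA=\mathbb Z^d$ whose cone $C=\mathbb R_{\ge 0}A$ is strongly convex. Let $\mathcal F$ be the set of facets of $C$ and, for $\sigma\in\mathcal F$, let $F_\sigma$ be its primitive integral support function: the linear form on $\mathbb R^d$ with $F_\sigma\ge 0$ on $C$, $F_\sigma(\sigma)=0$, $F_\sigma(\mathbb Z^d)=\mathbb Z$. A set $T\subseteq\mathbb Z^d$ is an $\mathbb NA$-set if $T+\mathbb NA\subseteq T$; it is finitely generated if $T=G+\mathbb NA$ with $G$ finite, and scored if $T=\bigcap_{\sigma\in\mathcal F}\{a\in\mathbb Z^d: F_\sigma(a)\in F_\sigma(T)\}$. Let $S_c$ be a finitely generated scored $\mathbb NA$-set, let $b_1,\dots,b_m\in S_c$, and let $\tau_1,\dots,\tau_m$ be faces of $C$ such that the expression $$S=S_c\setminus\bigcup_{i=1}^m\bigl(b_i+\mathbb Z(A\cap\tau_i)\bigr)$$ is irredundant, $F_\sigma(S)=F_\sigma(S_c)$ for all $\sigma\in\mathcal F$, and $S$ is an $\mathbb NA$-set.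 Put $\tilde{\mathcal F}=\mathcal F\cup\{\tau_1,\dots,\tau_m\}$. For a face $\tau$ let $K\tau\subseteq K^d$ be the $K$-span of $A\cap\tau$. Let $\mathcal B$ be the set of families $(b_\tau)_{\tau\in\tilde{\mathcal F}}$ with $b_\tau\in (K\tau\cap\mathbb Z^d)/\mathbb Z(A\cap\tau)$ such that for all $i$ and all $\tau\in\tilde{\mathcal F}$ with $\tau\supseteq\tau_i$ there is $j$ with $\tau_j=\tau$ and $b_i+b_{\tau_i}\equiv b_j+b_{\tau_j}$ modulo $\mathbb Z(A\cap\tau)$. Given $(b_\tau)\in\mathcal B$, set $$\omega(S)=\{a\in\mathbb Z^d:\ -a-b_\tau\notin S+\mathbb Z(A\cap\tau)\text{ for each }\tau\in\tilde{\mathcal F}\}.$$ For $T\subseteq\mathbb Z^d$ let $K[T]=\bigoplus_{a\in T}Kt^a$, and let $D(T)$ be the ring of all differential operators $P$ (in the sense of Grothendieck) of the Laurent polynomial ring $K[\mathbb Z^d]$ with $P(K[T])\subseteq K[T]$. With $s_j=t_j\partial_j$, every such operator is a finite sum $P=\sum_a t^af_a(s)$ with $f_a\in K[s_1,\dots,s_d]$,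 and its formal adjoint is $P^*=\sum_a f_a(-s)t^a$. **Theorem.** Assume $\mathcal B\neq\emptyset$, and let $(b_\tau)$ be any element of $\mathcal B$, with $\omega(S)$ defined by it. Then there are one-to-one correspondences between left modules, left ideals, right modules, right ideals of $D(S)$ and right modules, right ideals, left modules, left ideals of $D(\omega(S))$, respectively. More precisely: 1. There is an equivalence from the category of left $D(S)$-modules to the category of right $D(\omega(S))$-modules which, up to natural isomorphism, keeps the underlying abelian group, and under which the right action of $P^*$ on the image of $M$ is the action of $P$ on $M$, whenever $P\in D(S)$ and $P^*\in D(\omega(S))$. 2. There is an inclusion-preserving bijection from the left ideals of $D(S)$ onto the right ideals of $D(\omega(S))$, given by $I\mapsto\{Q\in D(\omega(S)): Q=P^*\text{ for some }P\in I\}$. 3. There is an equivalence from the category of right $D(S)$-modules to the category of left $D(\omega(S))$-modules with the same properties as in 1 (with left and right exchanged). 4. There is an inclusion-preserving bijection from the right ideals of $D(S)$ onto the left ideals of $D(\omega(S))$, given by the same formula as in 2. -/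

import Mathlib

universe u w

open CategoryTheory
open scoped Pointwise

noncomputable section

namespace ToricDiff

/-! ### Differential operators (Grothendieck) -/

section Grothendieck

variable (K R M N : Type*) [Field K] [CommRing R] [Algebra K R]
  [AddCommGroup M] [Module K M] [Module R M] [IsScalarTower K R M]
  [AddCommGroup N] [Module K N] [Module R N] [IsScalarTower K R N]

/-- The `K`-linear map `P ↦ P r - r P` on `Hom_K(M, N)`, for `r ∈ R`. -/
def bracket (r : R) : (M →ₗ[K] N) →ₗ[K] (M →ₗ[K] N) where
  toFun P := P ∘ₗ Algebra.lsmul K K M r - Algebra.lsmul K K N r ∘ₗ P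
  map_add' P Q := by ext x; simp; abel
  map_smul' c P := by ext x; simp [smul_sub, smul_comm r c]

@[simp] theorem bracket_apply (r : R) (P : M →ₗ[K] N) (x : M) :
    bracket K R M N r P x = P (r • x) - r • P x := rfl

/-- The space `D^k(M, N)` of differential operators from `M` to `N` of order at most `k`
(with the convention `D^{-1}(M, N) = 0`). -/
def diffOpOfOrder : ℕ → Submodule K (M →ₗ[K] N)
  | 0 => ⨅ r : R, (⊥ : Submodule K (M →ₗ[K] N)).comap (bracket K R M N r)
  | k + 1 => ⨅ r : R, (diffOpOfOrder k).comap (bracket K R M N r)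

variable {K R M N}

theorem mem_diffOpOfOrder_zero {P : M →ₗ[K] N} :
    P ∈ diffOpOfOrder K R M N 0 ↔ ∀ r : R, bracket K R M N r P = 0 := by
  simp [diffOpOfOrder]

theorem mem_diffOpOfOrder_succ {k : ℕ} {P : M →ₗ[K] N} :
    P ∈ diffOpOfOrder K R M N (k + 1) ↔
      ∀ r : R, bracket K R M N r P ∈ diffOpOfOrder K R M N k := by
  simp [diffOpOfOrder]

theorem diffOpOfOrder_le_succ (k : ℕ) :
    diffOpOfOrder K R M N k ≤ diffOpOfOrder K R M N (k + 1) := by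
  induction k with
  | zero =>
    intro P hP
    rw [mem_diffOpOfOrder_succ]
    intro r
    rw [mem_diffOpOfOrder_zero.1 hP r]
    exact Submodule.zero_mem _
  | succ k ih =>
    intro P hP
    rw [mem_diffOpOfOrder_succ]
    exact fun r => ih (mem_diffOpOfOrder_succ.1 hP r)

theorem diffOpOfOrder_mono : Monotone (diffOpOfOrder K R M N) :=
  monotone_nat_of_le_succ diffOpOfOrder_le_succ

theorem bracket_mul (r : R) (P Q : Module.End K M) :
    bracket K R M M r (P * Q) = P * bracket K R M M r Q + bracket K R M M r P * Q := by
  ext x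
  simp

theorem mul_mem_diffOpOfOrder (n : ℕ) : ∀ (i j : ℕ) (P Q : Module.End K M), i + j = n →
    P ∈ diffOpOfOrder K R M M i → Q ∈ diffOpOfOrder K R M M j →
    P * Q ∈ diffOpOfOrder K R M M n := by
  induction n with
  | zero =>
    intro i j P Q hij hP hQ
    obtain ⟨rfl, rfl⟩ : i = 0 ∧ j = 0 := by omega
    rw [mem_diffOpOfOrder_zero] at hP hQ ⊢
    intro r
    rw [bracket_mul, hP r, hQ r]
    simp
  | succ n ih =>
    intro i j P Q hij hP hQ
    rw [mem_diffOpOfOrder_succ]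
    intro r
    rw [bracket_mul]
    refine Submodule.add_mem _ ?_ ?_
    · cases j with
      | zero =>
        rw [mem_diffOpOfOrder_zero.1 hQ r, mul_zero]
        exact Submodule.zero_mem _
      | succ j => exact ih i j _ _ (by omega) hP (mem_diffOpOfOrder_succ.1 hQ r)
    · cases i with
      | zero =>
        rw [mem_diffOpOfOrder_zero.1 hP r, zero_mul]
        exact Submodule.zero_mem _
      | succ i => exact ih i j _ _ (by omega) (mem_diffOpOfOrder_succ.1 hP r) hQ

variable (K R M)

/-- The ring `D(M) = ⋃ₖ D^k(M, M)` of differential operators of the `R`-module `M`. -/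
def diffOps : Subalgebra K (Module.End K M) where
  carrier := {P | ∃ k, P ∈ diffOpOfOrder K R M M k}
  mul_mem' := by
    rintro P Q ⟨i, hP⟩ ⟨j, hQ⟩
    exact ⟨i + j, mul_mem_diffOpOfOrder (i + j) i j P Q rfl hP hQ⟩
  add_mem' := by
    rintro P Q ⟨i, hP⟩ ⟨j, hQ⟩
    exact ⟨max i j, Submodule.add_mem _ (diffOpOfOrder_mono (le_max_left i j) hP)
      (diffOpOfOrder_mono (le_max_right i j) hQ)⟩
  algebraMap_mem' := by
    intro c
    refine ⟨0, mem_diffOpOfOrder_zero.2 fun r => ?_⟩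
    ext x
    simp [smul_comm r c]

end Grothendieck

/-! ### Differential operators on the Laurent polynomial ring and the rings `D(S)` -/

/-- The Laurent polynomial ring `K[ℤᵈ]`. -/
abbrev Laurent (K : Type*) [Field K] (d : ℕ) : Type _ := AddMonoidAlgebra K (Fin d → ℤ)

/-- The monomial `t^a`. -/
abbrev mono (K : Type*) [Field K] {d : ℕ} (a : Fin d → ℤ) : Laurent K d :=
  AddMonoidAlgebra.single a 1

/-- `K[S] = ⨁_{a ∈ S} K t^a`, as a subspace of `K[ℤᵈ]`. -/
def monoSpan (K : Type*) [Field K] {d : ℕ} (S : Set (Fin d → ℤ)) : Submodule K (Laurent K d) :=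
  Submodule.span K (mono K '' S)

/-- `D(S) = {P ∈ D(ℤᵈ) : P(K[S]) ⊆ K[S]}`, where `D(ℤᵈ) = D(K[ℤᵈ])`. -/
def D (K : Type*) [Field K] {d : ℕ} (S : Set (Fin d → ℤ)) :
    Subalgebra K (Module.End K (Laurent K d)) where
  carrier := {P | P ∈ diffOps K (Laurent K d) (Laurent K d) ∧
    ∀ f ∈ monoSpan K S, P f ∈ monoSpan K S}
  mul_mem' := fun hP hQ => ⟨mul_mem hP.1 hQ.1, fun f hf => hP.2 _ (hQ.2 f hf)⟩
  add_mem' := fun hP hQ =>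
    ⟨add_mem hP.1 hQ.1, fun f hf => Submodule.add_mem _ (hP.2 f hf) (hQ.2 f hf)⟩
  algebraMap_mem' := fun c =>
    ⟨Subalgebra.algebraMap_mem _ c, fun f hf => by
      simpa using Submodule.smul_mem _ c hf⟩

/-- The operator `∑_a t^a f_a(s)`, where `s_j = t_j ∂_j`. Since `s_j t^b = b_j t^b`, the operator
`t^a f_a(s)` sends `t^b` to `f_a(b) t^{a+b}`. -/
def IsNormalForm (K : Type*) [Field K] {d : ℕ} (f : (Fin d → ℤ) →₀ MvPolynomial (Fin d) K)
    (P : Module.End K (Laurent K d)) : Prop :=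
  ∀ b : Fin d → ℤ, P (mono K b) =
    f.sum fun a p => MvPolynomial.eval (fun j => (b j : K)) p • mono K (a + b)

/-- The operator `∑_a f_a(-s) t^a`; the operator `f_a(-s) t^a` sends `t^b` to
`f_a(-(a+b)) t^{a+b}`. -/
def IsAdjointForm (K : Type*) [Field K] {d : ℕ} (f : (Fin d → ℤ) →₀ MvPolynomial (Fin d) K)
    (Q : Module.End K (Laurent K d)) : Prop :=
  ∀ b : Fin d → ℤ, Q (mono K b) =
    f.sum fun a p => MvPolynomial.eval (fun j => -((a j : K) + (b j : K))) p • mono K (a + b)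

/-- `Q = P^*` is the formal adjoint of `P`: if `P = ∑_a t^a f_a(s)` then `Q = ∑_a f_a(-s) t^a`. -/
def IsFormalAdjoint (K : Type*) [Field K] {d : ℕ} (P Q : Module.End K (Laurent K d)) : Prop :=
  ∃ f : (Fin d → ℤ) →₀ MvPolynomial (Fin d) K, IsNormalForm K f P ∧ IsAdjointForm K f Q

/-! ### The cone, its faces and facets -/

section Cone

variable {d : ℕ}

/-- The inclusion `ℤᵈ ⊆ ℝᵈ`. -/
def toReal (a : Fin d → ℤ) : Fin d → ℝ := fun j => (a j : ℝ)

/-- The cone `ℝ_{≥0} A`. -/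
def cone (A : Finset (Fin d → ℤ)) : PointedCone ℝ (Fin d → ℝ) :=
  PointedCone.hull ℝ (toReal '' (A : Set (Fin d → ℤ)))

/-- Faces of the polyhedral cone `ℝ_{≥0} A`: its intersections with the hyperplanes `ℓ = 0`, for
linear forms `ℓ` nonnegative on the cone (the cone itself is the case `ℓ = 0`). -/
def IsFace (A : Finset (Fin d → ℤ)) (τ : PointedCone ℝ (Fin d → ℝ)) : Prop :=
  ∃ l : (Fin d → ℝ) →ₗ[ℝ] ℝ, (∀ x ∈ cone A, 0 ≤ l x) ∧ ∀ x, x ∈ τ ↔ x ∈ cone A ∧ l x = 0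

/-- Facets: faces of codimension one. -/
def IsFacet (A : Finset (Fin d → ℤ)) (σ : PointedCone ℝ (Fin d → ℝ)) : Prop :=
  IsFace A σ ∧ Module.finrank ℝ (Submodule.span ℝ (σ : Set (Fin d → ℝ))) + 1 = d

/-- `F` is the primitive integral support function `F_σ` of the facet `σ`. -/
def IsSupportFunction (A : Finset (Fin d → ℤ)) (σ : PointedCone ℝ (Fin d → ℝ))
    (F : (Fin d → ℝ) →ₗ[ℝ] ℝ) : Prop :=
  (∀ x ∈ cone A, 0 ≤ F x) ∧ (∀ x ∈ σ, F x = 0) ∧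
    (Set.range fun a : Fin d → ℤ => F (toReal a)) = Set.range fun k : ℤ => (k : ℝ)

/-- `F(S)` for `S ⊆ ℤᵈ`. -/
def values (F : (Fin d → ℝ) →ₗ[ℝ] ℝ) (S : Set (Fin d → ℤ)) : Set ℝ :=
  (fun a => F (toReal a)) '' S

/-- The monoid `ℕA`. -/
def monoid (A : Finset (Fin d → ℤ)) : AddSubmonoid (Fin d → ℤ) :=
  AddSubmonoid.closure (A : Set (Fin d → ℤ))

/-- `ℕA`-sets: `S + ℕA ⊆ S`. -/
def IsNASet (A : Finset (Fin d → ℤ)) (S : Set (Fin d → ℤ)) : Prop :=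
  S + (monoid A : Set (Fin d → ℤ)) ⊆ S

/-- Finitely generated `ℕA`-sets: `S = G + ℕA` with `G` finite. -/
def IsFGNASet (A : Finset (Fin d → ℤ)) (S : Set (Fin d → ℤ)) : Prop :=
  ∃ G : Finset (Fin d → ℤ), S = (G : Set (Fin d → ℤ)) + (monoid A : Set (Fin d → ℤ))

/-- `S = ⋂_σ {a ∈ ℤᵈ : F_σ(a) ∈ F_σ(S)}`, the intersection over all facets `σ`. -/
def IsScored (A : Finset (Fin d → ℤ)) (S : Set (Fin d → ℤ)) : Prop :=
  S = {a | ∀ σ F, IsFacet A σ → IsSupportFunction A σ F → F (toReal a) ∈ values F S}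

/-- The group `ℤ(A ∩ τ)`. -/
def faceGroup (A : Finset (Fin d → ℤ)) (τ : PointedCone ℝ (Fin d → ℝ)) :
    AddSubgroup (Fin d → ℤ) :=
  AddSubgroup.closure {a | a ∈ A ∧ toReal a ∈ τ}

/-- The group `Kτ ∩ ℤᵈ`, where `Kτ ⊆ Kᵈ` is the `K`-linear span of `A ∩ τ`. -/
def faceLattice (K : Type*) [Field K] (A : Finset (Fin d → ℤ))
    (τ : PointedCone ℝ (Fin d → ℝ)) : Set (Fin d → ℤ) :=
  {a | (fun j => (a j : K)) ∈
    Submodule.span K ((fun (c : Fin d → ℤ) (j : Fin d) => (c j : K)) '' {c | c ∈ A ∧ toReal c ∈ τ})}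

/-- The coset `b + ℤ(A ∩ τ)`. -/
def faceCoset (A : Finset (Fin d → ℤ)) (b : Fin d → ℤ) (τ : PointedCone ℝ (Fin d → ℝ)) :
    Set (Fin d → ℤ) :=
  {a | a - b ∈ faceGroup A τ}

/-- `S = Sc \ ⋃ᵢ (bᵢ + ℤ(A ∩ τᵢ))` is a standard expression of `S`, with scored closure `Sc`. -/
structure IsStandardExpression (A : Finset (Fin d → ℤ)) (Sc S : Set (Fin d → ℤ)) {m : ℕ}
    (b : Fin m → Fin d → ℤ) (τ : Fin m → PointedCone ℝ (Fin d → ℝ)) : Prop where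
  isNASet : IsNASet A Sc
  fg : IsFGNASet A Sc
  scored : IsScored A Sc
  mem : ∀ i, b i ∈ Sc
  isFace : ∀ i, IsFace A (τ i)
  eq : S = Sc \ ⋃ i, faceCoset A (b i) (τ i)
  values_eq : ∀ σ F, IsFacet A σ → IsSupportFunction A σ F → values F S = values F Sc
  irredundant : ∀ k, Sc \ (⋃ i, ⋃ (_ : i ≠ k), faceCoset A (b i) (τ i)) ≠ S

/-- `F̃ = F ∪ {τᵢ}`, where `F` is the set of facets. -/
def tildeFacets (A : Finset (Fin d → ℤ)) {m : ℕ} (τ : Fin m → PointedCone ℝ (Fin d → ℝ)) :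
    Set (PointedCone ℝ (Fin d → ℝ)) :=
  {σ | IsFacet A σ} ∪ Set.range τ

/-- The set `𝓑`. A family of classes in `(Kσ ∩ ℤᵈ)/ℤ(A ∩ σ)`, `σ ∈ F̃`, is given by
representatives `β σ`; values of `β` outside `F̃` play no role. -/
def setB (K : Type*) [Field K] (A : Finset (Fin d → ℤ)) {m : ℕ} (b : Fin m → Fin d → ℤ)
    (τ : Fin m → PointedCone ℝ (Fin d → ℝ)) : Set (PointedCone ℝ (Fin d → ℝ) → Fin d → ℤ) :=
  {β | (∀ σ ∈ tildeFacets A τ, β σ ∈ faceLattice K A σ) ∧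
    ∀ i, ∀ σ ∈ tildeFacets A τ, τ i ≤ σ →
      ∃ j, τ j = σ ∧ (b i + β (τ i)) - (b j + β (τ j)) ∈ faceGroup A σ}

/-- `ω(S) = {a ∈ ℤᵈ : -a - β σ ∉ S + ℤ(A ∩ σ) for each σ ∈ F̃}`; it depends only on the class of
`β σ` modulo `ℤ(A ∩ σ)`. -/
def omega (A : Finset (Fin d → ℤ)) (S : Set (Fin d → ℤ)) {m : ℕ}
    (τ : Fin m → PointedCone ℝ (Fin d → ℝ)) (β : PointedCone ℝ (Fin d → ℝ) → Fin d → ℤ) :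
    Set (Fin d → ℤ) :=
  {a | ∀ σ ∈ tildeFacets A τ, -a - β σ ∉ S + (faceGroup A σ : Set (Fin d → ℤ))}

end Cone

/-! ### Functors between module categories that keep the underlying abelian groups -/

/-- If `F` commutes with the forgetful functors to abelian groups, up to the natural isomorphism
`e`, this is the resulting identification of the abelian group `F(M)` with the abelian group `M`
(it is bijective, since `e` is an isomorphism). -/
def groupIso {R R' : Type*} [Ring R] [Ring R'] {F : ModuleCat.{w} R ⥤ ModuleCat.{w} R'}
    (e : F ⋙ forget₂ (ModuleCat.{w} R') AddCommGrpCat.{w} ≅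
      forget₂ (ModuleCat.{w} R) AddCommGrpCat.{w})
    (M : ModuleCat.{w} R) : F.obj M →+ M :=
  (e.hom.app M).hom

end ToricDiff

end

/-!
The formal adjoint `P ↦ P^*` is the transpose for the perfect pairing of `K[ℤᵈ]` with itself given
by the constant coefficient of a product, so it is an anti-automorphism of the ring of differential
operators of `K[ℤᵈ]`. Everything follows once it is known to exchange `D(S)` and `D(ω(S))`: the
resulting ring isomorphism `D(S) ≃ D(ω(S))ᵐᵒᵖ` (`exists_antiIso`) identifies module categories by
restriction of scalars, and ideals by images (`correspondences_of_antiIso`).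

Every differential operator is a finite sum `∑ t^a f_a(s)` (`exists_isNormalForm`): its
coefficients are functions on `ℤᵈ` whose differences are, by induction on the order, polynomial.
Such an operator preserves `K[S]` if and only if each `f_a` vanishes on `{s ∈ S : a + s ∉ S}`
(`IsNormalForm.mem_D_iff`). After the substitution `f_a(s) ↦ f_a(-a-s)`, its adjoint preserves
`K[ω(S)]` if and only if each `f_a` vanishes on `{e ∈ T : a + e ∉ T}`, where `T = coOmega` is the
complement of `-ω(S)`, that is, the union of the sets `β σ + S + ℤ(A ∩ σ)` for `σ ∈ F̃`. So the
point is that these two sets have the same Zariski closure (`forall_eval_eq_zero_iff_coOmega`).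
Closures are computed with the fact that `c + ℕB` is Zariski dense in `c + KB`.

* A point `e = β σ + s + z` of the second set, with `s ∈ S` and `z ∈ ℤ(A ∩ σ)`, lies in `s + Kσ`,
  and `s + ℕ(A ∩ σ)` is contained in the first set (`eval_eq_zero_of_mem_coOmega`).
* Let `s` be in the first set. Then either `F_ρ(a + s) ∉ F_ρ(Sc)` for some facet `ρ`, or
  `a + s ∈ bᵢ + ℤ(A ∩ τᵢ)` for some `i`. Let `σ₀` be `ρ` or `τᵢ`, accordingly. The points
  `e = s + β σ₀ - z`, with `z` deep inside `ℕ(A ∩ σ₀)`, are dense in `s + Kσ₀`. They are in `T`, and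
  `a + e` is not in `β σ + S + ℤ(A ∩ σ)` for any `σ`: if `σ` does not contain `σ₀`, then the form
  defining `σ` is too small at `a + e`; if it does, this follows from the value of `F_ρ`, or from
  the condition that defines `𝓑` (`eval_eq_zero_of_forall_notMem`).
-/

noncomputable section

namespace ToricDiff

/-! ### Coefficients of operators on Laurent polynomials -/

section NormalForms

variable {K : Type*} [Field K] {d : ℕ}

theorem mono_mul_mono (a b : Fin d → ℤ) : mono K a * mono K b = mono K (a + b) := by
  simp [mono, AddMonoidAlgebra.single_mul_single]

/-- Induction on Laurent polynomials, from monomials by sums and scalar multiples. -/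
theorem laurent_induction {motive : Laurent K d → Prop} (x : Laurent K d) (zero : motive 0)
    (add : ∀ x y, motive x → motive y → motive (x + y))
    (smul_mono : ∀ (c : K) b, motive (c • mono K b)) : motive x := by
  induction x using AddMonoidAlgebra.induction_linear with
  | zero => exact zero
  | add x y hx hy => exact add x y hx hy
  | single b c =>
    have := smul_mono c b
    rwa [mono, AddMonoidAlgebra.smul_single, smul_eq_mul, mul_one] at this

theorem end_ext_mono {P Q : Module.End K (Laurent K d)}
    (h : ∀ b, P (mono K b) = Q (mono K b)) : P = Q := by
  refine LinearMap.ext fun x => ?_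
  induction x using laurent_induction with
  | zero => simp
  | add x y hx hy => simp [hx, hy]
  | smul_mono c b => rw [map_smul, map_smul, h]

theorem coeff_mono_mul (a : Fin d → ℤ) (x : Laurent K d) (b : Fin d → ℤ) :
    (mono K a * x).coeff (a + b) = x.coeff b := by
  rw [mono, AddMonoidAlgebra.coeff_single_mul_eq_mul_coeff b (fun _ _ => by simp), one_mul]

theorem coeff_sum_smul_mono (f : (Fin d → ℤ) →₀ MvPolynomial (Fin d) K)
    (g : (Fin d → ℤ) → Fin d → K) (a b : Fin d → ℤ) :
    (f.sum fun a p => MvPolynomial.eval (g a) p • mono K (a + b)).coeff (a + b) =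
      MvPolynomial.eval (g a) (f a) := by
  classical
  rw [AddMonoidAlgebra.coeff_finsuppSum, Finsupp.sum_apply, Finsupp.sum]
  simp only [AddMonoidAlgebra.coeff_smul, AddMonoidAlgebra.coeff_single, Finsupp.smul_apply,
    Finsupp.single_apply, add_left_inj, smul_eq_mul, mul_ite, mul_one, mul_zero]
  rw [Finset.sum_ite_eq']
  split_ifs with h
  · rfl
  · rw [Finsupp.notMem_support_iff.1 h, map_zero]

theorem eq_iff_coeff_add (x y : Laurent K d) (b : Fin d → ℤ) :
    x = y ↔ ∀ a, x.coeff (a + b) = y.coeff (a + b) := by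
  refine ⟨fun h a => by rw [h], fun h => AddMonoidAlgebra.coeff_injective <|
    Finsupp.ext fun a => ?_⟩
  simpa using h (a - b)

theorem isNormalForm_iff {f : (Fin d → ℤ) →₀ MvPolynomial (Fin d) K}
    {P : Module.End K (Laurent K d)} :
    IsNormalForm K f P ↔ ∀ a b : Fin d → ℤ,
      (P (mono K b)).coeff (a + b) = MvPolynomial.eval (fun j => (b j : K)) (f a) := by
  rw [forall_comm]
  refine forall_congr' fun b => ?_
  rw [eq_iff_coeff_add _ _ b]
  refine forall_congr' fun a => ?_
  rw [coeff_sum_smul_mono f (fun _ j => (b j : K))]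

theorem isAdjointForm_iff {f : (Fin d → ℤ) →₀ MvPolynomial (Fin d) K}
    {Q : Module.End K (Laurent K d)} :
    IsAdjointForm K f Q ↔ ∀ a b : Fin d → ℤ,
      (Q (mono K b)).coeff (a + b) =
        MvPolynomial.eval (fun j => -((a j : K) + (b j : K))) (f a) := by
  rw [forall_comm]
  refine forall_congr' fun b => ?_
  rw [eq_iff_coeff_add _ _ b]
  refine forall_congr' fun a => ?_
  rw [coeff_sum_smul_mono f (fun a j => -((a j : K) + (b j : K)))]

/-! ### Polynomial functions on the lattice -/

variable (K d) in
/-- The algebra of functions `ℤᵈ → K` given by polynomials. -/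
def polyFun : Subalgebra K ((Fin d → ℤ) → K) :=
  (MvPolynomial.aeval fun (j : Fin d) (b : Fin d → ℤ) => (b j : K)).range

theorem aeval_coord_apply (p : MvPolynomial (Fin d) K) (b : Fin d → ℤ) :
    MvPolynomial.aeval (fun (j : Fin d) (b : Fin d → ℤ) => (b j : K)) p b =
      MvPolynomial.eval (fun j => (b j : K)) p := by
  induction p using MvPolynomial.induction_on with
  | C c => simp
  | add p q hp hq => simp [hp, hq]
  | mul_X p j hp => simp [hp]

theorem mem_polyFun {c : (Fin d → ℤ) → K} :
    c ∈ polyFun K d ↔ ∃ p : MvPolynomial (Fin d) K,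
      ∀ b, c b = MvPolynomial.eval (fun j => (b j : K)) p := by
  simp only [polyFun, AlgHom.mem_range, funext_iff, aeval_coord_apply, eq_comm]

theorem coord_mem_polyFun (j : Fin d) : (fun b : Fin d → ℤ => (b j : K)) ∈ polyFun K d :=
  mem_polyFun.2 ⟨MvPolynomial.X j, by simp⟩

/-- A polynomial in a single variable gives a polynomial function of any coordinate. -/
theorem eval_coord_mem_polyFun (p : Polynomial K) (j : Fin d) :
    (fun b : Fin d → ℤ => p.eval (b j : K)) ∈ polyFun K d := by
  have : (fun b : Fin d → ℤ => p.eval (b j : K)) =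
      Polynomial.aeval (fun b : Fin d → ℤ => (b j : K)) p := by
    ext b
    simp [Polynomial.aeval_eq_sum_range, Polynomial.eval_eq_sum_range]
  rw [this, Polynomial.aeval_eq_sum_range]
  exact sum_mem fun i _ => Subalgebra.smul_mem _ (pow_mem (coord_mem_polyFun j) i) _

/-- Setting the coordinates in a set `J` to zero keeps polynomial functions polynomial. -/
theorem comp_zeroOut_mem_polyFun {c : (Fin d → ℤ) → K} (hc : c ∈ polyFun K d)
    (J : Finset (Fin d)) :
    (fun b => c fun i => if i ∈ J then 0 else b i) ∈ polyFun K d := by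
  obtain ⟨p, hp⟩ := mem_polyFun.1 hc
  refine mem_polyFun.2 ⟨MvPolynomial.aeval (fun i => if i ∈ J then 0 else MvPolynomial.X i) p,
    fun b => ?_⟩
  rw [hp, ← MvPolynomial.coe_aeval_eq_eval, ← MvPolynomial.coe_aeval_eq_eval, RingHom.coe_coe,
    RingHom.coe_coe, ← AlgHom.comp_apply, MvPolynomial.comp_aeval]
  congr 2
  ext i
  split_ifs <;> simp

/-- The Bernoulli polynomials provide polynomial solutions `q` of `q (x + 1) - q x = x ^ n`. -/
theorem exists_antidifference_pow [CharZero K] (n : ℕ) :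
    ∃ q : Polynomial K, ∀ x : ℤ, q.eval ((x : K) + 1) - q.eval (x : K) = (x : K) ^ n := by
  refine ⟨((Polynomial.bernoulli (n + 1)).map (algebraMap ℚ K)) *
    Polynomial.C ((n + 1 : K)⁻¹), fun x => ?_⟩
  have h := congrArg (algebraMap ℚ K) (Polynomial.bernoulli_eval_one_add (n + 1) (x : ℚ))
  have h1 : ∀ y : ℚ, algebraMap ℚ K ((Polynomial.bernoulli (n + 1)).eval y) =
      ((Polynomial.bernoulli (n + 1)).map (algebraMap ℚ K)).eval (y : K) := by
    intro y
    rw [← eq_ratCast (algebraMap ℚ K), Polynomial.eval_map_apply]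
  have hn : (n + 1 : K) ≠ 0 := by exact_mod_cast n.succ_ne_zero
  rw [map_add, h1, h1, map_mul, map_pow, map_intCast, map_natCast, Rat.cast_add, Rat.cast_one,
    Rat.cast_intCast, add_comm (1 : K), Nat.add_sub_cancel, Nat.cast_add, Nat.cast_one] at h
  rw [Polynomial.eval_mul, Polynomial.eval_mul, Polynomial.eval_C, Polynomial.eval_C, h]
  field_simp
  ring

/-- Polynomial functions have polynomial antidifferences in each direction. -/
theorem exists_antidifference [CharZero K] {c : (Fin d → ℤ) → K} (hc : c ∈ polyFun K d) (j : Fin d) :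
    ∃ q ∈ polyFun K d, ∀ b, q (b + Pi.single j 1) - q b = c b := by
  obtain ⟨p, hp⟩ := mem_polyFun.1 hc
  obtain rfl : c = fun b => MvPolynomial.eval (fun j => (b j : K)) p := funext hp
  clear hp hc
  induction p using MvPolynomial.induction_on' with
  | monomial u r =>
    obtain ⟨q, hq⟩ := exists_antidifference_pow (K := K) (u j)
    refine ⟨(fun b => q.eval (b j : K)) *
      (algebraMap K _ r * ∏ i ∈ Finset.univ.erase j, (fun b : Fin d → ℤ => (b i : K)) ^ u i),
      mul_mem (eval_coord_mem_polyFun q j) (mul_mem (Subalgebra.algebraMap_mem _ _)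
        (prod_mem fun i _ => pow_mem (coord_mem_polyFun i) _)), fun b => ?_⟩
    have h1 : ∏ i ∈ Finset.univ.erase j, (((b + Pi.single j 1 : Fin d → ℤ) i : ℤ) : K) ^ u i =
        ∏ i ∈ Finset.univ.erase j, (b i : K) ^ u i :=
      Finset.prod_congr rfl fun i hi => by simp [Finset.ne_of_mem_erase hi]
    have h2 : MvPolynomial.eval (fun j => (b j : K)) (MvPolynomial.monomial u r) =
        r * ((b j : K) ^ u j * ∏ i ∈ Finset.univ.erase j, (b i : K) ^ u i) := by
      rw [MvPolynomial.eval_monomial, Finset.mul_prod_erase _ (fun i => (b i : K) ^ u i)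
        (Finset.mem_univ j), Finsupp.prod_fintype _ _ (fun i => by simp)]
    simp only [Pi.mul_apply, Finset.prod_apply, Pi.pow_apply, Pi.algebraMap_apply,
      Algebra.algebraMap_self, RingHom.id_apply]
    rw [h1, h2, ← hq]
    simp
    ring
  | add p q hp hq =>
    obtain ⟨q₁, h₁, h₁'⟩ := hp
    obtain ⟨q₂, h₂, h₂'⟩ := hq
    refine ⟨q₁ + q₂, add_mem h₁ h₂, fun b => ?_⟩
    simp only [Pi.add_apply, map_add, ← h₁', ← h₂']
    ring

theorem eq_apply_zero_of_differences_eq_zero {X : Type*} {c : (Fin d → ℤ) → X}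
    (h : ∀ j b, c (b + Pi.single j 1) = c b) (b : Fin d → ℤ) : c b = c 0 := by
  have h1 : ∀ J : Finset (Fin d), Function.Periodic c (∑ j ∈ J, b j • Pi.single j (1 : ℤ)) := by
    intro J
    induction J using Finset.induction_on with
    | empty => intro x; simp
    | insert j J hj ih =>
      rw [Finset.sum_insert hj]
      exact Function.Periodic.add_period (Function.Periodic.zsmul (h j) _) ih
  have h2 : ∑ j, b j • Pi.single j (1 : ℤ) = b := by
    ext i
    simp [Finset.sum_apply, Pi.single_apply]
  have h3 := h1 Finset.univ 0
  rwa [h2, zero_add] at h3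

/-- A function on `ℤᵈ` all of whose first differences are polynomial is polynomial: telescope
along the coordinates, setting them to zero one after the other. -/
theorem mem_polyFun_of_differences [CharZero K] {c : (Fin d → ℤ) → K}
    (h : ∀ j, (fun b => c (b + Pi.single j 1) - c b) ∈ polyFun K d) : c ∈ polyFun K d := by
  suffices ∀ J : Finset (Fin d), (fun b : Fin d → ℤ => c fun i => if i ∈ Jᶜ then 0 else b i) ∈
      polyFun K d by
    simpa using this Finset.univ
  intro J
  induction J using Finset.induction_on with
  | empty => 
    have h0 : (fun b : Fin d → ℤ => c fun i => if i ∈ (∅ : Finset (Fin d))ᶜ then 0 else b i) =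
        algebraMap K _ (c 0) := by
      ext b
      simp only [Finset.compl_empty, Finset.mem_univ, if_true, Pi.algebraMap_apply]
      rfl
    rw [h0]
    exact Subalgebra.algebraMap_mem _ _
  | insert j J hj ih =>
    obtain ⟨q, hq, hq'⟩ := exists_antidifference (h j) j
    have hper : Function.Periodic (c - q) (Pi.single j 1) := by
      intro b
      have := hq' b
      simp only [Pi.sub_apply]
      linear_combination -this
    convert add_mem ih (sub_mem (comp_zeroOut_mem_polyFun hq (insert j J)ᶜ)
      (comp_zeroOut_mem_polyFun hq Jᶜ)) using 1
    ext b
    have h1 : (fun i => if i ∈ (insert j J)ᶜ then 0 else b i) =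
        (fun i => if i ∈ Jᶜ then 0 else b i) + b j • Pi.single j (1 : ℤ) := by
      ext i
      by_cases hi : i = j
      · subst hi; simp [hj]
      · simp [hi]
    have h2 := (hper.zsmul (b j)) fun i => if i ∈ Jᶜ then 0 else b i
    simp only [Pi.add_apply, Pi.sub_apply, h1] at h2 ⊢
    linear_combination h2

theorem mvPolynomial_eq_zero_of_eval_lattice [CharZero K] {p : MvPolynomial (Fin d) K}
    (h : ∀ b : Fin d → ℤ, MvPolynomial.eval (fun j => (b j : K)) p = 0) : p = 0 := by
  refine MvPolynomial.funext_set (fun _ => Set.range ((↑) : ℤ → K))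
    (fun _ => Set.infinite_range_of_injective Int.cast_injective) fun x hx => ?_
  choose b hb using fun j => hx j (Set.mem_univ j)
  simpa [hb] using h b

/-! ### Differential operators and normal forms -/

/-- An operator `P` whose commutators with the `t_j` have normal forms has a normal form: the
coefficient of `t^(a+b)` in `P t^b`, as a function of `b`, has polynomial differences, which vanish
for almost all `a`. -/
theorem exists_isNormalForm_of_bracket [CharZero K] {P : Module.End K (Laurent K d)}
    (h : ∀ j, ∃ f, IsNormalForm K f
      (bracket K (Laurent K d) (Laurent K d) (Laurent K d) (mono K (Pi.single j 1)) P)) :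
    ∃ f, IsNormalForm K f P := by
  classical
  choose f hf using h
  set c : (Fin d → ℤ) → (Fin d → ℤ) → K := fun a b => (P (mono K b)).coeff (a + b) with hc
  have hdiff : ∀ a j b, c a (b + Pi.single j 1) - c a b =
      MvPolynomial.eval (fun i => (b i : K)) (f j (a + Pi.single j 1)) := by
    intro a j b
    have h1 := isNormalForm_iff.1 (hf j) (a + Pi.single j 1) b
    rw [← h1, bracket_apply, smul_eq_mul, smul_eq_mul, mono_mul_mono, AddMonoidAlgebra.coeff_sub,
      Finsupp.sub_apply, add_comm a, add_assoc, coeff_mono_mul]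
    simp only [hc]
    rw [add_comm b, add_left_comm]
  have hpoly : ∀ a, c a ∈ polyFun K d := fun a => mem_polyFun_of_differences fun j =>
    mem_polyFun.2 ⟨_, hdiff a j⟩
  choose p hp using fun a => mem_polyFun.1 (hpoly a)
  refine ⟨Finsupp.onFinset ((P (mono K 0)).coeff.support ∪ Finset.univ.biUnion fun j =>
    (f j).support.image fun a => a - Pi.single j 1) p fun a ha => ?_, isNormalForm_iff.2 hp⟩
  by_contra hmem
  simp only [Finset.mem_union, Finset.mem_biUnion, Finset.mem_image, not_or, not_exists, not_and,
    Finset.mem_univ, true_and, Finsupp.notMem_support_iff] at hmem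
  refine ha (mvPolynomial_eq_zero_of_eval_lattice fun b => ?_)
  rw [← hp, eq_apply_zero_of_differences_eq_zero (c := c a) ?_ b]
  · simpa [hc] using hmem.1
  · intro j b
    rw [← sub_eq_zero, hdiff]
    by_cases h0 : f j (a + Pi.single j 1) = 0
    · rw [h0, map_zero]
    · exact absurd (add_sub_cancel_right a _)
        (hmem.2 j (a + Pi.single j 1) (Finsupp.mem_support_iff.2 h0))

theorem exists_isNormalForm [CharZero K] {P : Module.End K (Laurent K d)}
    (hP : P ∈ diffOps K (Laurent K d) (Laurent K d)) : ∃ f, IsNormalForm K f P := by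
  obtain ⟨k, hk⟩ := hP
  induction k generalizing P with
  | zero =>
    refine exists_isNormalForm_of_bracket fun j => ⟨0, fun b => ?_⟩
    rw [mem_diffOpOfOrder_zero.1 hk]
    simp
  | succ k ih =>
    exact exists_isNormalForm_of_bracket fun j => ih (mem_diffOpOfOrder_succ.1 hk _)

theorem mulLeft_mem_diffOps (x : Laurent K d) :
    LinearMap.mulLeft K x ∈ diffOps K (Laurent K d) (Laurent K d) :=
  ⟨0, mem_diffOpOfOrder_zero.2 fun r => by 
    refine LinearMap.ext fun y => ?_
    simp [mul_left_comm]⟩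

variable (K) in
/-- The operator `s_j = t_j ∂_j`, which multiplies `t^b` by `b_j`. -/
def euler (j : Fin d) : Module.End K (Laurent K d) :=
  (AddMonoidAlgebra.basis (Fin d → ℤ) K).constr K fun b => (b j : K) • mono K b

theorem euler_mono (j : Fin d) (b : Fin d → ℤ) : euler K j (mono K b) = (b j : K) • mono K b := by
  have : mono K b = AddMonoidAlgebra.basis (Fin d → ℤ) K b := by
    simp
  rw [euler, this, Module.Basis.constr_basis, ← this]

theorem euler_mul (j : Fin d) (x y : Laurent K d) :
    euler K j (x * y) = euler K j x * y + x * euler K j y := by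
  induction x using laurent_induction with
  | zero => simp
  | add x x' hx hx' => simp only [add_mul, map_add, hx, hx']; abel
  | smul_mono c a =>
    induction y using laurent_induction with
    | zero => simp
    | add y y' hy hy' => simp only [mul_add, map_add, hy, hy']; abel
    | smul_mono c' b =>
      simp only [smul_mul_assoc, mul_smul_comm, map_smul, mono_mul_mono, euler_mono, smul_smul,
        ← add_smul]
      congr 1
      push_cast [Pi.add_apply]
      ring

theorem euler_mem_diffOps (j : Fin d) : euler K j ∈ diffOps K (Laurent K d) (Laurent K d) := by
  refine ⟨1, mem_diffOpOfOrder_succ.2 fun r => mem_diffOpOfOrder_zero.2 fun r' => ?_⟩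
  refine LinearMap.ext fun x => ?_
  simp only [bracket_apply, smul_eq_mul, euler_mul, LinearMap.zero_apply]
  ring

/-- Every operator with a normal form is a differential operator, being a polynomial in the `s_j`
and the multiplications by monomials. -/
theorem IsNormalForm.mem_diffOps {f : (Fin d → ℤ) →₀ MvPolynomial (Fin d) K}
    {P : Module.End K (Laurent K d)} (hP : IsNormalForm K f P) :
    P ∈ diffOps K (Laurent K d) (Laurent K d) := by
  have h : ∀ p : MvPolynomial (Fin d) K, ∃ E ∈ diffOps K (Laurent K d) (Laurent K d),
      ∀ b, E (mono K b) = MvPolynomial.eval (fun j => (b j : K)) p • mono K b := by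
    intro p
    induction p using MvPolynomial.induction_on with
    | C c => exact ⟨algebraMap K _ c, Subalgebra.algebraMap_mem _ _, by simp⟩
    | add p q hp hq =>
      obtain ⟨E, hE, hE'⟩ := hp
      obtain ⟨G, hG, hG'⟩ := hq
      exact ⟨E + G, add_mem hE hG, fun b => by simp [hE', hG', add_smul]⟩
    | mul_X p j hp =>
      obtain ⟨E, hE, hE'⟩ := hp
      refine ⟨euler K j * E, mul_mem (euler_mem_diffOps j) hE, fun b => ?_⟩
      rw [Module.End.mul_apply, hE', map_smul, euler_mono, smul_smul]
      simp
  choose E hE hE' using h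
  have hPE : P = f.sum fun a p => LinearMap.mulLeft K (mono K a) * E p := by
    refine end_ext_mono fun b => (hP b).trans ?_
    simp only [Finsupp.sum, LinearMap.sum_apply, Module.End.mul_apply, hE', map_smul,
      LinearMap.mulLeft_apply, mono_mul_mono]
  rw [hPE]
  exact sum_mem fun a _ => mul_mem (mulLeft_mem_diffOps _) (hE _)

theorem exists_operator_of_normalForm (f : (Fin d → ℤ) →₀ MvPolynomial (Fin d) K) :
    ∃ P : Module.End K (Laurent K d), IsNormalForm K f P :=
  ⟨(AddMonoidAlgebra.basis (Fin d → ℤ) K).constr K fun b =>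
    f.sum fun a p => MvPolynomial.eval (fun j => (b j : K)) p • mono K (a + b), fun b => by
    have : mono K b = AddMonoidAlgebra.basis (Fin d → ℤ) K b := by simp
    rw [this, Module.Basis.constr_basis]⟩

end NormalForms

/-! ### The formal adjoint as a transpose -/

section Transpose

variable {K : Type*} [Field K] {d : ℕ}

/-- `Q` is the transpose of `P` with respect to the perfect pairing of `K[ℤᵈ]` with itself that
takes `x, y` to the constant coefficient of `x * y`. -/
def IsTranspose (P Q : Module.End K (Laurent K d)) : Prop :=
  ∀ x y : Laurent K d, (P x * y).coeff 0 = (x * Q y).coeff 0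

theorem coeff_zero_mul_mono (x : Laurent K d) (c : Fin d → ℤ) :
    (x * mono K c).coeff 0 = x.coeff (-c) := by
  rw [mul_comm, ← coeff_mono_mul c x (-c), add_neg_cancel]

theorem isTranspose_iff {P Q : Module.End K (Laurent K d)} :
    IsTranspose P Q ↔
      ∀ b c, (P (mono K b)).coeff (-c) = (Q (mono K c)).coeff (-b) := by
  refine ⟨fun h b c => ?_, fun h x y => ?_⟩
  · rw [← coeff_zero_mul_mono, ← coeff_zero_mul_mono, h, mul_comm]
  · induction x using laurent_induction with
    | zero => simp
    | add x x' hx hx' => simp [add_mul, hx, hx']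
    | smul_mono r b =>
      induction y using laurent_induction with
      | zero => simp
      | add y y' hy hy' =>
        rw [mul_add, map_add, mul_add, AddMonoidAlgebra.coeff_add, AddMonoidAlgebra.coeff_add,
          Finsupp.add_apply, Finsupp.add_apply, hy, hy']
      | smul_mono r' c =>
        simp only [map_smul, smul_mul_assoc, mul_smul_comm, AddMonoidAlgebra.coeff_smul,
          Finsupp.smul_apply]
        rw [coeff_zero_mul_mono, h, mul_comm, coeff_zero_mul_mono]

theorem IsTranspose.symm {P Q : Module.End K (Laurent K d)} (h : IsTranspose P Q) :
    IsTranspose Q P := fun x y => by rw [mul_comm, ← h, mul_comm]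

theorem IsTranspose.right_unique {P Q Q' : Module.End K (Laurent K d)} (h : IsTranspose P Q)
    (h' : IsTranspose P Q') : Q = Q' := by
  refine end_ext_mono fun c => AddMonoidAlgebra.coeff_injective <| Finsupp.ext fun b => ?_
  rw [← neg_neg b, ← isTranspose_iff.1 h, ← isTranspose_iff.1 h']

theorem IsTranspose.left_unique {P P' Q : Module.End K (Laurent K d)} (h : IsTranspose P Q)
    (h' : IsTranspose P' Q) : P = P' :=
  h.symm.right_unique h'.symm

theorem IsTranspose.add {P P' Q Q' : Module.End K (Laurent K d)} (h : IsTranspose P Q)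
    (h' : IsTranspose P' Q') : IsTranspose (P + P') (Q + Q') := fun x y => by
  simp [add_mul, mul_add, h x y, h' x y]

theorem IsTranspose.mul {P P' Q Q' : Module.End K (Laurent K d)} (h : IsTranspose P Q)
    (h' : IsTranspose P' Q') : IsTranspose (P * P') (Q' * Q) := fun x y => by
  rw [Module.End.mul_apply, Module.End.mul_apply, h, h']

theorem IsNormalForm.isAdjointForm_iff_isTranspose {f : (Fin d → ℤ) →₀ MvPolynomial (Fin d) K}
    {P Q : Module.End K (Laurent K d)} (hP : IsNormalForm K f P) :
    IsAdjointForm K f Q ↔ IsTranspose P Q := by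
  rw [isAdjointForm_iff, isTranspose_iff]
  rw [isNormalForm_iff] at hP
  refine ⟨fun h b c => ?_, fun h a b => ?_⟩
  · have h1 := hP (-b - c) b
    have h2 := h (-b - c) c
    rw [show -b - c + b = -c by abel] at h1
    rw [sub_add_cancel] at h2
    rw [h1, h2]
    congr 2
    ext j
    push_cast [Pi.sub_apply, Pi.neg_apply]
    ring
  · have h1 := hP a (-(a + b))
    have h2 := h (-(a + b)) b
    rw [neg_neg, show -b = a + -(a + b) by abel, h1] at h2
    rw [← h2]
    congr 2
    ext j
    push_cast [Pi.add_apply, Pi.neg_apply]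
    ring

theorem isFormalAdjoint_iff_isTranspose [CharZero K] {P Q : Module.End K (Laurent K d)}
    (hP : P ∈ diffOps K (Laurent K d) (Laurent K d)) :
    IsFormalAdjoint K P Q ↔ IsTranspose P Q := by
  refine ⟨fun ⟨f, hf, hf'⟩ => hf.isAdjointForm_iff_isTranspose.1 hf', fun h => ?_⟩
  obtain ⟨f, hf⟩ := exists_isNormalForm hP
  exact ⟨f, hf, hf.isAdjointForm_iff_isTranspose.2 h⟩

/-- The coefficients of the normal form of the formal adjoint: `f_a(-s) t^a = t^a f_a(-a-s)`. -/
def adjointCoeffs (f : (Fin d → ℤ) →₀ MvPolynomial (Fin d) K) :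
    (Fin d → ℤ) →₀ MvPolynomial (Fin d) K :=
  Finsupp.onFinset f.support
    (fun a => MvPolynomial.aeval
      (fun j => -(MvPolynomial.C (a j : K) + MvPolynomial.X j)) (f a))
    (fun a h => Finsupp.mem_support_iff.2 fun h0 => h (by rw [h0, map_zero]))

theorem eval_adjointCoeffs (f : (Fin d → ℤ) →₀ MvPolynomial (Fin d) K) (a : Fin d → ℤ)
    (x : Fin d → K) : MvPolynomial.eval x (adjointCoeffs f a) =
      MvPolynomial.eval (fun j => -((a j : K) + x j)) (f a) := by
  rw [adjointCoeffs, Finsupp.onFinset_apply]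
  rw [← MvPolynomial.coe_aeval_eq_eval, ← MvPolynomial.coe_aeval_eq_eval, RingHom.coe_coe,
    RingHom.coe_coe, ← AlgHom.comp_apply, MvPolynomial.comp_aeval]
  congr 2
  ext i
  simp

theorem isAdjointForm_iff_isNormalForm {f : (Fin d → ℤ) →₀ MvPolynomial (Fin d) K}
    {Q : Module.End K (Laurent K d)} :
    IsAdjointForm K f Q ↔ IsNormalForm K (adjointCoeffs f) Q := by
  simp only [isAdjointForm_iff, isNormalForm_iff, eval_adjointCoeffs]

theorem exists_isTranspose [CharZero K] {P : Module.End K (Laurent K d)}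
    (hP : P ∈ diffOps K (Laurent K d) (Laurent K d)) :
    ∃ Q ∈ diffOps K (Laurent K d) (Laurent K d), IsTranspose P Q := by
  obtain ⟨f, hf⟩ := exists_isNormalForm hP
  obtain ⟨Q, hQ⟩ := exists_operator_of_normalForm (adjointCoeffs f)
  exact ⟨Q, hQ.mem_diffOps,
    hf.isAdjointForm_iff_isTranspose.1 (isAdjointForm_iff_isNormalForm.2 hQ)⟩

theorem mem_monoSpan_iff {S : Set (Fin d → ℤ)} {x : Laurent K d} :
    x ∈ monoSpan K S ↔ ∀ a ∉ S, x.coeff a = 0 := by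
  refine ⟨fun hx a ha => ?_, fun hx => ?_⟩
  · induction hx using Submodule.span_induction with
    | mem x hx =>
      obtain ⟨b, hb, rfl⟩ := hx
      exact Finsupp.single_eq_of_ne (fun h => ha (h ▸ hb))
    | zero => rfl
    | add x y _ _ hx hy => rw [AddMonoidAlgebra.coeff_add, Finsupp.add_apply, hx, hy, add_zero]
    | smul c x _ hx => rw [AddMonoidAlgebra.coeff_smul, Finsupp.smul_apply, hx, smul_zero]
  · rw [← AddMonoidAlgebra.sum_coeff_single x, Finsupp.sum]
    refine sum_mem fun a _ => ?_
    by_cases ha : a ∈ S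
    · rw [← mul_one (x.coeff a), ← smul_eq_mul, ← AddMonoidAlgebra.smul_single]
      exact Submodule.smul_mem _ _ (Submodule.subset_span ⟨a, ha, rfl⟩)
    · rw [hx a ha, AddMonoidAlgebra.single_zero]
      exact Submodule.zero_mem _

/-- The operator `∑ t^a f_a(s)` lies in `D(S)` if and only if each `f_a` vanishes at all points
`b ∈ S` with `a + b ∉ S`. -/
theorem IsNormalForm.mem_D_iff {f : (Fin d → ℤ) →₀ MvPolynomial (Fin d) K}
    {P : Module.End K (Laurent K d)} (hP : IsNormalForm K f P) {S : Set (Fin d → ℤ)} :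
    P ∈ D K S ↔ ∀ a, ∀ b ∈ S, a + b ∉ S →
      MvPolynomial.eval (fun j => (b j : K)) (f a) = 0 := by
  have h1 := isNormalForm_iff.1 hP
  refine ⟨fun h a b hb hab => ?_, fun h => ⟨hP.mem_diffOps, fun x hx => ?_⟩⟩
  · rw [← h1]
    exact mem_monoSpan_iff.1 (h.2 _ (Submodule.subset_span ⟨b, hb, rfl⟩)) _ hab
  · suffices monoSpan K S ≤ (monoSpan K S).comap P from this hx
    refine Submodule.span_le.2 ?_
    rintro _ ⟨b, hb, rfl⟩
    refine mem_monoSpan_iff.2 fun a ha => ?_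
    have h2 := h1 (a - b) b
    rw [sub_add_cancel] at h2
    rw [h2]
    exact h _ b hb (by rwa [sub_add_cancel])

end Transpose

/-! ### Zariski density of lattice cones -/

section Density

variable {K : Type*} [Field K] {d : ℕ}

/-- The map `ℤᵈ → Kᵈ`. -/
def latticeCast (K : Type*) [Field K] (d : ℕ) : (Fin d → ℤ) →+ (Fin d → K) :=
  (Int.castAddHom K).compLeft (Fin d)

theorem latticeCast_apply (a : Fin d → ℤ) : latticeCast K d a = fun j => (a j : K) := rfl

theorem eval_add_smul_eq_zero [CharZero K] {p : MvPolynomial (Fin d) K} {x v : Fin d → K}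
    (h : ∀ n : ℕ, MvPolynomial.eval (x + n • v) p = 0) (r : K) :
    MvPolynomial.eval (x + r • v) p = 0 := by
  set q : Polynomial K :=
    MvPolynomial.aeval (fun i => Polynomial.C (x i) + Polynomial.X * Polynomial.C (v i)) p with hq
  have hqr : ∀ r : K, q.eval r = MvPolynomial.eval (x + r • v) p := by
    intro r
    rw [hq, ← Polynomial.coe_aeval_eq_eval, ← MvPolynomial.coe_aeval_eq_eval, RingHom.coe_coe,
      ← AlgHom.comp_apply, MvPolynomial.comp_aeval]
    congr 2
    ext i
    simp
    exact mul_comm _ _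
  rw [← hqr]
  have hq0 : q = 0 := by
    refine Polynomial.eq_zero_of_infinite_isRoot q
      ((Set.infinite_range_of_injective (Nat.cast_injective (R := K))).mono ?_)
    rintro _ ⟨n, rfl⟩
    have := h n
    rw [← Nat.cast_smul_eq_nsmul K] at this
    rw [Set.mem_ofPred_eq, Polynomial.IsRoot, hqr, this]
  rw [hq0, Polynomial.eval_zero]

/-- A polynomial vanishing on `c + ℕB` vanishes at all lattice points of `c + KB`. -/
theorem eval_eq_zero_of_add_closure [CharZero K] {p : MvPolynomial (Fin d) K}
    {B : Set (Fin d → ℤ)} {c : Fin d → ℤ}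
    (h : ∀ z ∈ AddSubmonoid.closure B, MvPolynomial.eval (latticeCast K d (c + z)) p = 0)
    {e : Fin d → ℤ}
    (he : latticeCast K d (e - c) ∈ Submodule.span K (latticeCast K d '' B)) :
    MvPolynomial.eval (latticeCast K d e) p = 0 := by
  -- the set of `w` with `p = 0` on `w + ℕB` is stable under translation by `KB`
  have key : ∀ v ∈ Submodule.span K (latticeCast K d '' B), ∀ (r : K) (w : Fin d → K),
      (∀ z ∈ AddSubmonoid.closure B, MvPolynomial.eval (w + latticeCast K d z) p = 0) →
      ∀ z ∈ AddSubmonoid.closure B,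
        MvPolynomial.eval (w + r • v + latticeCast K d z) p = 0 := by
    intro v hv
    induction hv using Submodule.span_induction with
    | mem v hv =>
      obtain ⟨b, hb, rfl⟩ := hv
      intro r w hw z hz
      rw [add_right_comm]
      refine eval_add_smul_eq_zero (fun n => ?_) r
      have := hw (z + n • b) (add_mem hz (nsmul_mem (AddSubmonoid.subset_closure hb) n))
      rwa [map_add, map_nsmul, ← add_assoc] at this
    | zero => intro r w hw z hz; simpa using hw z hz
    | add v v' _ _ hv hv' =>
      intro r w hw z hz
      rw [smul_add, ← add_assoc]
      exact hv' r _ (hv r w hw) z hz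
    | smul r' v _ hv =>
      intro r w hw z hz
      rw [smul_smul]
      exact hv _ w hw z hz
  have := key _ he 1 (latticeCast K d c) (fun z hz => by rw [← map_add]; exact h z hz) 0
    (zero_mem _)
  simpa [← map_add] using this

theorem eval_eq_zero_of_sub_closure [CharZero K] {p : MvPolynomial (Fin d) K}
    {B : Set (Fin d → ℤ)} {c : Fin d → ℤ}
    (h : ∀ z ∈ AddSubmonoid.closure B, MvPolynomial.eval (latticeCast K d (c - z)) p = 0)
    {e : Fin d → ℤ}
    (he : latticeCast K d (e - c) ∈ Submodule.span K (latticeCast K d '' B)) :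
    MvPolynomial.eval (latticeCast K d e) p = 0 := by
  refine eval_eq_zero_of_add_closure (B := -B) (c := c) (fun z hz => ?_) ?_
  · rw [AddSubmonoid.closure_neg, AddSubmonoid.mem_neg] at hz
    simpa using h _ hz
  · have : latticeCast K d '' (-B) = -(latticeCast K d '' B) := Set.image_neg (latticeCast K d) B
    rwa [this, Submodule.span_neg]

/-- Whether a lattice point is in the linear span of a set of lattice points does not depend on the
field of characteristic zero, as such a field has a `ℚ`-linear retraction onto `ℚ`. -/
theorem latticeCast_mem_span_of_mem_span (E : Type*) [Field E] [CharZero K] [CharZero E]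
    {B : Set (Fin d → ℤ)} {a : Fin d → ℤ}
    (ha : latticeCast K d a ∈ Submodule.span K (latticeCast K d '' B)) :
    latticeCast E d a ∈ Submodule.span E (latticeCast E d '' B) := by
  obtain ⟨φ, hφ⟩ := (Algebra.linearMap ℚ K).exists_leftInverse_of_injective
    (LinearMap.ker_eq_bot.2 (algebraMap ℚ K).injective)
  have hint : ∀ (r : K) (n : ℤ), φ (r * n) = φ r * n := by
    intro r n
    rw [mul_comm, ← zsmul_eq_mul, map_zsmul, zsmul_eq_mul, mul_comm]
  have key : ∀ x ∈ Submodule.span K (latticeCast K d '' B), ∀ r : K,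
      (fun j => ((φ (r * x j) : ℚ) : E)) ∈ Submodule.span E (latticeCast E d '' B) := by
    intro x hx
    induction hx using Submodule.span_induction with
    | mem x hx =>
      obtain ⟨b, hb, rfl⟩ := hx
      intro r
      convert Submodule.smul_mem _ ((φ r : ℚ) : E)
        (Submodule.subset_span (Set.mem_image_of_mem (latticeCast E d) hb)) using 1
      ext j
      simp [latticeCast_apply, hint]
    | zero =>
      intro r
      convert Submodule.zero_mem (Submodule.span E (latticeCast E d '' B)) using 1
      ext j
      simp
    | add x y _ _ hx hy =>
      intro r
      convert Submodule.add_mem _ (hx r) (hy r) using 1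
      ext j
      simp [mul_add]
    | smul r' x _ hx =>
      intro r
      simpa [mul_assoc] using hx (r * r')
  have h1 : φ 1 = 1 := by simpa using LinearMap.congr_fun hφ 1
  convert key _ ha 1 using 1
  ext j
  simp only [latticeCast_apply, hint, h1]
  simp

end Density

/-! ### Faces of the cone -/

section Faces

variable {d : ℕ} {A : Finset (Fin d → ℤ)}

theorem toReal_eq_latticeCast : toReal = latticeCast ℝ d := rfl

theorem toReal_add (a b : Fin d → ℤ) : toReal (a + b) = toReal a + toReal b := by
  simp [toReal_eq_latticeCast]

theorem toReal_sub (a b : Fin d → ℤ) : toReal (a - b) = toReal a - toReal b := by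
  simp [toReal_eq_latticeCast]

theorem toReal_nsmul (n : ℕ) (a : Fin d → ℤ) : toReal (n • a) = n • toReal a := by
  rw [toReal_eq_latticeCast, map_nsmul]

theorem toReal_mem_cone {a : Fin d → ℤ} (ha : a ∈ A) : toReal a ∈ cone A :=
  Submodule.subset_span ⟨a, ha, rfl⟩

/-- The elements of `A` in a face, which generate the face as a cone. -/
def faceSet (A : Finset (Fin d → ℤ)) (τ : PointedCone ℝ (Fin d → ℝ)) : Set (Fin d → ℤ) :=
  {a | a ∈ A ∧ toReal a ∈ τ}

theorem closure_faceSet_le_faceGroup (τ : PointedCone ℝ (Fin d → ℝ)) {z : Fin d → ℤ}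
    (hz : z ∈ AddSubmonoid.closure (faceSet A τ)) : z ∈ faceGroup A τ := by
  induction hz using AddSubmonoid.closure_induction with
  | mem x hx => exact AddSubgroup.subset_closure hx
  | zero => exact zero_mem _
  | add x y _ _ hx hy => exact add_mem hx hy

theorem closure_faceSet_le_monoid (τ : PointedCone ℝ (Fin d → ℝ)) :
    AddSubmonoid.closure (faceSet A τ) ≤ monoid A :=
  AddSubmonoid.closure_mono fun _ h => h.1

theorem latticeCast_faceGroup_mem_span (K : Type*) [Field K] (τ : PointedCone ℝ (Fin d → ℝ))
    {z : Fin d → ℤ} (hz : z ∈ faceGroup A τ) :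
    latticeCast K d z ∈ Submodule.span K (latticeCast K d '' faceSet A τ) := by
  induction hz using AddSubgroup.closure_induction with
  | mem x hx => exact Submodule.subset_span ⟨x, hx, rfl⟩
  | zero => rw [map_zero]; exact zero_mem _
  | add x y _ _ hx hy => rw [map_add]; exact add_mem hx hy
  | neg x _ hx => rw [map_neg]; exact neg_mem hx

theorem mem_faceLattice {K : Type*} [Field K] {τ : PointedCone ℝ (Fin d → ℝ)}
    {a : Fin d → ℤ} : a ∈ faceLattice K A τ ↔
      latticeCast K d a ∈ Submodule.span K (latticeCast K d '' faceSet A τ) := Iff.rfl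

theorem apply_eq_zero_of_mem_span {τ : PointedCone ℝ (Fin d → ℝ)}
    {l : (Fin d → ℝ) →ₗ[ℝ] ℝ} (hl : ∀ x ∈ τ, l x = 0) {a : Fin d → ℤ}
    (ha : latticeCast ℝ d a ∈ Submodule.span ℝ (latticeCast ℝ d '' faceSet A τ)) :
    l (toReal a) = 0 := by
  suffices Submodule.span ℝ (latticeCast ℝ d '' faceSet A τ) ≤ LinearMap.ker l from this ha
  refine Submodule.span_le.2 ?_
  rintro _ ⟨c, hc, rfl⟩
  exact hl _ hc.2

theorem apply_faceGroup_eq_zero {τ : PointedCone ℝ (Fin d → ℝ)}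
    {l : (Fin d → ℝ) →ₗ[ℝ] ℝ} (hl : ∀ x ∈ τ, l x = 0) {z : Fin d → ℤ}
    (hz : z ∈ faceGroup A τ) : l (toReal z) = 0 :=
  apply_eq_zero_of_mem_span hl (latticeCast_faceGroup_mem_span ℝ τ hz)

theorem apply_faceLattice_eq_zero {K : Type*} [Field K] [CharZero K]
    {τ : PointedCone ℝ (Fin d → ℝ)}
    {l : (Fin d → ℝ) →ₗ[ℝ] ℝ} (hl : ∀ x ∈ τ, l x = 0) {a : Fin d → ℤ}
    (ha : a ∈ faceLattice K A τ) : l (toReal a) = 0 :=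
  apply_eq_zero_of_mem_span hl (latticeCast_mem_span_of_mem_span ℝ (mem_faceLattice.1 ha))

theorem apply_monoid_nonneg {l : (Fin d → ℝ) →ₗ[ℝ] ℝ} (hl : ∀ x ∈ cone A, 0 ≤ l x)
    {z : Fin d → ℤ} (hz : z ∈ monoid A) : 0 ≤ l (toReal z) := by
  induction hz using AddSubmonoid.closure_induction with
  | mem x hx => exact hl _ (toReal_mem_cone hx)
  | zero => simp [toReal_eq_latticeCast]
  | add x y _ _ hx hy => rw [toReal_add, map_add]; exact add_nonneg hx hy

/-- A face is generated by its elements of `A`: a face containing these contains the face. -/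
theorem IsFace.le_of_faceSet {τ σ : PointedCone ℝ (Fin d → ℝ)} (hτ : IsFace A τ)
    (hσ : IsFace A σ) (h : ∀ c ∈ faceSet A τ, toReal c ∈ σ) : τ ≤ σ := by
  obtain ⟨l, hl, hlτ⟩ := hτ
  obtain ⟨k, hk, hkσ⟩ := hσ
  have key : ∀ x ∈ cone A, l x = 0 → k x = 0 := by
    intro x hx
    induction hx using Submodule.span_induction with
    | mem x hx =>
      obtain ⟨c, hc, rfl⟩ := hx
      exact fun h0 => ((hkσ _).1 (h c ⟨hc, (hlτ _).2 ⟨toReal_mem_cone hc, h0⟩⟩)).2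
    | zero => simp
    | add x y hx hy ihx ihy =>
      intro h0
      rw [map_add] at h0 ⊢
      have h1 := hl x hx
      have h2 := hl y hy
      rw [ihx (by linarith), ihy (by linarith), add_zero]
    | smul r x hx ih =>
      intro h0
      have hr : ∀ f : (Fin d → ℝ) →ₗ[ℝ] ℝ, f (r • x) = (r : ℝ) * f x := fun f => by
        rw [← smul_eq_mul, ← map_smul]; rfl
      rw [hr] at h0 ⊢
      rcases mul_eq_zero.1 h0 with h0 | h0
      · rw [h0, zero_mul]
      · rw [ih h0, mul_zero]
  exact fun x hx => (hkσ x).2 ⟨((hlτ x).1 hx).1, key x ((hlτ x).1 hx).1 ((hlτ x).1 hx).2⟩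

theorem finite_faces (A : Finset (Fin d → ℤ)) : {σ | IsFace A σ}.Finite := by
  refine Set.Finite.of_finite_image (f := faceSet A) ?_ fun τ hτ σ hσ h => ?_
  · refine A.finite_toSet.finite_subsets.subset ?_
    rintro _ ⟨σ, -, rfl⟩
    exact fun _ h => h.1
  · have h : faceSet A τ = faceSet A σ := h
    exact le_antisymm (hτ.le_of_faceSet hσ fun c hc => (h ▸ hc : c ∈ faceSet A σ).2)
      (hσ.le_of_faceSet hτ fun c hc => (h.symm ▸ hc : c ∈ faceSet A τ).2)

theorem IsFGNASet.exists_lower_bound {S : Set (Fin d → ℤ)} (hS : IsFGNASet A S)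
    {l : (Fin d → ℝ) →ₗ[ℝ] ℝ} (hl : ∀ x ∈ cone A, 0 ≤ l x) :
    ∃ M : ℝ, ∀ s ∈ S, M ≤ l (toReal s) := by
  obtain ⟨G, rfl⟩ := hS
  obtain ⟨M, hM⟩ := (G.finite_toSet.image fun g => l (toReal g)).bddBelow
  refine ⟨M, ?_⟩
  rintro _ ⟨g, hg, z, hz, rfl⟩
  have h1 := hM (Set.mem_image_of_mem _ hg)
  have h2 := apply_monoid_nonneg hl hz
  simp only [toReal_add, map_add]
  linarith

/-- Moving backwards along a face `τ` not contained in `σ`, one leaves `S + ℤ(A ∩ σ)` forever: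
the form defining `σ` is bounded below on `S`, and it is positive on some
element of `A ∩ τ`. -/
theorem exists_sub_notMem_add_faceGroup {S : Set (Fin d → ℤ)} {τ σ : PointedCone ℝ (Fin d → ℝ)}
    (hτ : IsFace A τ) (hσ : IsFace A σ) (hτσ : ¬ τ ≤ σ)
    (hS : ∀ l : (Fin d → ℝ) →ₗ[ℝ] ℝ, (∀ x ∈ cone A, 0 ≤ l x) →
      ∃ M : ℝ, ∀ s ∈ S, M ≤ l (toReal s)) (x : Fin d → ℤ) :
    ∃ u ∈ AddSubmonoid.closure (faceSet A τ),
      ∀ z ∈ AddSubmonoid.closure (faceSet A τ),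
        x - (u + z) ∉ S + (faceGroup A σ : Set (Fin d → ℤ)) := by
  obtain ⟨c, hc, hcσ⟩ : ∃ c ∈ faceSet A τ, toReal c ∉ σ := by
    by_contra! h
    exact hτσ (hτ.le_of_faceSet hσ h)
  obtain ⟨l, hl, hlσ⟩ := hσ
  obtain ⟨M, hM⟩ := hS l hl
  have hlc : 0 < l (toReal c) :=
    lt_of_le_of_ne (hl _ (toReal_mem_cone hc.1)) fun h =>
      hcσ ((hlσ _).2 ⟨toReal_mem_cone hc.1, h.symm⟩)
  obtain ⟨n, hn⟩ := exists_nat_gt ((l (toReal x) - M) / l (toReal c))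
  rw [div_lt_iff₀ hlc] at hn
  refine ⟨n • c, nsmul_mem (AddSubmonoid.subset_closure hc) n, ?_⟩
  rintro z hz ⟨s, hs, g, hg, hsg : s + g = _⟩
  have h1 := hM s hs
  have h2 := apply_faceGroup_eq_zero (fun y hy => ((hlσ y).1 hy).2) hg
  have h3 := apply_monoid_nonneg hl (closure_faceSet_le_monoid τ hz)
  have h4 := congrArg (fun y => l (toReal y)) hsg
  simp only [toReal_add, toReal_sub, toReal_nsmul, map_add, map_sub, map_nsmul] at h4
  rw [nsmul_eq_mul] at h4
  linarith

/-- A form that vanishes on a facet is a multiple of its support function. -/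
theorem IsSupportFunction.eq_zero_or_apply_eq_zero {ρ : PointedCone ℝ (Fin d → ℝ)}
    {F l : (Fin d → ℝ) →ₗ[ℝ] ℝ} (hρ : IsFacet A ρ) (hF : IsSupportFunction A ρ F)
    (hl : ∀ x ∈ ρ, l x = 0) : l = 0 ∨ ∀ x, l x = 0 → F x = 0 := by
  obtain ⟨u, hu⟩ : ∃ u, F u = 1 := by
    have : (1 : ℝ) ∈ Set.range fun a : Fin d → ℤ => F (toReal a) := by
      rw [hF.2.2]; exact ⟨1, by simp⟩
    obtain ⟨a, ha⟩ := this
    exact ⟨_, ha⟩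
  have hle : Submodule.span ℝ (ρ : Set (Fin d → ℝ)) ≤ LinearMap.ker F :=
    Submodule.span_le.2 fun x hx => hF.2.1 x hx
  have hspan : Submodule.span ℝ (ρ : Set (Fin d → ℝ)) = LinearMap.ker F := by
    refine Submodule.eq_of_le_of_finrank_le hle ?_
    have h1 := F.finrank_range_add_finrank_ker
    have h2 : LinearMap.range F = ⊤ := LinearMap.range_eq_top.2 fun r => ⟨r • u, by simp [hu]⟩
    rw [h2, finrank_top, Module.finrank_self, Module.finrank_fin_fun] at h1
    have h3 := hρ.2
    omega
  have hker : LinearMap.ker F ≤ LinearMap.ker l := by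
    rw [← hspan]
    exact Submodule.span_le.2 fun x hx => hl x hx
  have hmul : ∀ x, l x = F x * l u := by
    intro x
    have : l (x - F x • u) = 0 := hker (by simp [hu])
    rw [map_sub, map_smul, smul_eq_mul] at this
    linarith
  by_cases h0 : l u = 0
  · exact Or.inl (LinearMap.ext fun x => by simp [hmul x, h0])
  · exact Or.inr fun x hx => (mul_eq_zero.1 ((hmul x).symm.trans hx)).resolve_right h0

end Faces

/-! ### The complement of `-ω(S)` -/

section CoOmega

variable {K : Type*} [Field K] {d : ℕ} {A : Finset (Fin d → ℤ)} {S : Set (Fin d → ℤ)}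
  {m : ℕ} {τ : Fin m → PointedCone ℝ (Fin d → ℝ)} {β : PointedCone ℝ (Fin d → ℝ) → Fin d → ℤ}

/-- The complement of `-ω(S)`, that is, the union of the sets `β σ + S + ℤ(A ∩ σ)`. -/
def coOmega (A : Finset (Fin d → ℤ)) (S : Set (Fin d → ℤ)) {m : ℕ}
    (τ : Fin m → PointedCone ℝ (Fin d → ℝ)) (β : PointedCone ℝ (Fin d → ℝ) → Fin d → ℤ) :
    Set (Fin d → ℤ) :=
  {e | ∃ σ ∈ tildeFacets A τ, e - β σ ∈ S + (faceGroup A σ : Set (Fin d → ℤ))}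

theorem mem_omega_iff {a : Fin d → ℤ} : a ∈ omega A S τ β ↔ -a ∉ coOmega A S τ β := by
  simp [omega, coOmega]

theorem isFace_of_mem_tildeFacets (hτ : ∀ i, IsFace A (τ i)) {σ : PointedCone ℝ (Fin d → ℝ)}
    (hσ : σ ∈ tildeFacets A τ) : IsFace A σ := by
  rcases hσ with hσ | ⟨i, rfl⟩
  · exact hσ.1
  · exact hτ i

theorem finite_tildeFacets (hτ : ∀ i, IsFace A (τ i)) : (tildeFacets A τ).Finite :=
  (finite_faces A).subset fun _ hσ => isFace_of_mem_tildeFacets hτ hσ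

/-- If `e = β σ + s + z` with `s ∈ S` and `z ∈ ℤ(A ∩ σ)`, and `a + e` is outside the union, then
`a + s + ℤ(A ∩ σ)` misses `S`. Hence the polynomial vanishes on `s + ℕ(A ∩ σ)`, and by density
at `e`. -/
theorem eval_eq_zero_of_mem_coOmega [CharZero K] (hS : IsNASet A S)
    (hβ : ∀ σ ∈ tildeFacets A τ, β σ ∈ faceLattice K A σ)
    {p : MvPolynomial (Fin d) K} {a : Fin d → ℤ}
    (hp : ∀ s ∈ S, a + s ∉ S → MvPolynomial.eval (latticeCast K d s) p = 0)
    {e : Fin d → ℤ} (he : e ∈ coOmega A S τ β) (hae : a + e ∉ coOmega A S τ β) :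
    MvPolynomial.eval (latticeCast K d e) p = 0 := by
  obtain ⟨σ, hσ, s, hs, z, hz, hsz : s + z = e - β σ⟩ := he
  refine eval_eq_zero_of_add_closure (B := faceSet A σ) (c := s) (fun w hw => ?_) ?_
  · refine hp _ (hS (Set.add_mem_add hs (closure_faceSet_le_monoid σ hw))) fun h => ?_
    refine hae ⟨σ, hσ, a + (s + w), h, z - w,
      sub_mem hz (closure_faceSet_le_faceGroup σ hw), ?_⟩
    change a + (s + w) + (z - w) = a + e - β σ
    rw [add_sub_assoc, ← hsz]
    abel
  · rw [show e - s = z + β σ by rw [← sub_eq_iff_eq_add, sub_right_comm, ← hsz]; abel, map_add]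
    exact add_mem (latticeCast_faceGroup_mem_span K σ hz) (mem_faceLattice.1 (hβ σ hσ))

/-- The points `s + β σ₀ - z`, with `z` deep inside `ℕ(A ∩ σ₀)`, are in the union but, under the
hypothesis, their translates by `a` are not. They are Zariski dense in `s + Kσ₀`. -/
theorem eval_eq_zero_of_forall_notMem [CharZero K] (hτ : ∀ i, IsFace A (τ i))
    (hβ : ∀ σ ∈ tildeFacets A τ, β σ ∈ faceLattice K A σ)
    (hbdd : ∀ l : (Fin d → ℝ) →ₗ[ℝ] ℝ, (∀ x ∈ cone A, 0 ≤ l x) →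
      ∃ M : ℝ, ∀ s ∈ S, M ≤ l (toReal s))
    {p : MvPolynomial (Fin d) K} {a : Fin d → ℤ}
    (hp : ∀ e ∈ coOmega A S τ β, a + e ∉ coOmega A S τ β →
      MvPolynomial.eval (latticeCast K d e) p = 0)
    {s : Fin d → ℤ} (hs : s ∈ S) {σ₀ : PointedCone ℝ (Fin d → ℝ)} (hσ₀ : σ₀ ∈ tildeFacets A τ)
    (h : ∀ σ ∈ tildeFacets A τ, σ₀ ≤ σ → ∀ z ∈ faceGroup A σ₀,
      a + s + β σ₀ - z - β σ ∉ S + (faceGroup A σ : Set (Fin d → ℤ))) :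
    MvPolynomial.eval (latticeCast K d s) p = 0 := by
  classical
  have hface : ∀ {σ}, σ ∈ tildeFacets A τ → IsFace A σ := isFace_of_mem_tildeFacets hτ
  have hu : ∀ σ, ∃ u ∈ AddSubmonoid.closure (faceSet A σ₀), σ ∈ tildeFacets A τ →
      ∀ z ∈ AddSubmonoid.closure (faceSet A σ₀),
        a + s + β σ₀ - (u + z) - β σ ∉ S + (faceGroup A σ : Set (Fin d → ℤ)) := by
    intro σ
    by_cases hσ : σ ∈ tildeFacets A τ
    · by_cases hle : σ₀ ≤ σ
      · refine ⟨0, zero_mem _, fun _ z hz => ?_⟩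
        rw [zero_add]
        exact h σ hσ hle z (closure_faceSet_le_faceGroup σ₀ hz)
      · obtain ⟨u, hu, hu'⟩ := exists_sub_notMem_add_faceGroup (hface hσ₀) (hface hσ) hle hbdd
          (a + s + β σ₀ - β σ)
        refine ⟨u, hu, fun _ z hz => ?_⟩
        rw [sub_right_comm]
        exact hu' z hz
    · exact ⟨0, zero_mem _, fun h => absurd h hσ⟩
  choose u hu hu' using hu
  set F := (finite_tildeFacets hτ).toFinset with hF
  set u₀ := ∑ σ ∈ F, u σ with hu₀
  have hu₀mem : u₀ ∈ AddSubmonoid.closure (faceSet A σ₀) := sum_mem fun σ _ => hu σ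
  refine eval_eq_zero_of_sub_closure (B := faceSet A σ₀) (c := s + β σ₀ - u₀) (fun z hz => ?_) ?_
  · refine hp _ ⟨σ₀, hσ₀, s, hs, -(u₀ + z),
      neg_mem (closure_faceSet_le_faceGroup σ₀ (add_mem hu₀mem hz)), ?_⟩ ?_
    · change s + -(u₀ + z) = _
      abel
    · rintro ⟨σ, hσ, hmem⟩
      have hσF : σ ∈ F := (finite_tildeFacets hτ).mem_toFinset.2 hσ
      refine hu' σ hσ (∑ σ' ∈ F.erase σ, u σ' + z)
        (add_mem (sum_mem fun σ _ => hu σ) hz) ?_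
      rw [← add_assoc, Finset.add_sum_erase _ _ hσF]
      convert hmem using 1
      abel
  · rw [show s - (s + β σ₀ - u₀) = u₀ - β σ₀ by abel, map_sub]
    exact sub_mem (latticeCast_faceGroup_mem_span K σ₀ (closure_faceSet_le_faceGroup σ₀ hu₀mem))
      (mem_faceLattice.1 (hβ σ₀ hσ₀))

variable {Sc : Set (Fin d → ℤ)} {b : Fin m → Fin d → ℤ}

theorem faceCoset_disjoint_add_faceGroup (hstd : IsStandardExpression A Sc S b τ) (j : Fin m)
    {x : Fin d → ℤ} (hx : x - b j ∈ faceGroup A (τ j)) :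
    x ∉ S + (faceGroup A (τ j) : Set (Fin d → ℤ)) := by
  rintro ⟨s, hs, z, hz, rfl⟩
  rw [hstd.eq] at hs
  refine hs.2 (Set.mem_iUnion.2 ⟨j, ?_⟩)
  change s - b j ∈ faceGroup A (τ j)
  have := sub_mem hx hz
  rwa [show s + z - b j - z = s - b j by abel] at this

/-- If a facet `ρ` is contained in `σ ∈ F̃`, and `S` is nonempty, then the support function of `ρ`
vanishes on `σ`: by dimension if `σ` is a facet, and because `σ` is a proper face if `σ = τᵢ`. -/
theorem IsSupportFunction.apply_eq_zero_of_le
    (hA : AddSubgroup.closure (A : Set (Fin d → ℤ)) = ⊤)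
    (hstd : IsStandardExpression A Sc S b τ) (hne : S.Nonempty)
    {ρ σ : PointedCone ℝ (Fin d → ℝ)} {F : (Fin d → ℝ) →ₗ[ℝ] ℝ} (hρ : IsFacet A ρ)
    (hF : IsSupportFunction A ρ F) (hσ : σ ∈ tildeFacets A τ) (hle : ρ ≤ σ) :
    ∀ x ∈ σ, F x = 0 := by
  rcases hσ with hσ | ⟨i, rfl⟩
  · have hspan : Submodule.span ℝ (ρ : Set (Fin d → ℝ)) = Submodule.span ℝ (σ : Set _) :=
      Submodule.eq_of_le_of_finrank_eq (Submodule.span_mono hle) (by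
        have h1 := hρ.2
        have h2 := hσ.2
        omega)
    have hker : Submodule.span ℝ (ρ : Set (Fin d → ℝ)) ≤ LinearMap.ker F :=
      Submodule.span_le.2 fun x hx => hF.2.1 x hx
    rw [hspan] at hker
    exact fun x hx => hker (Submodule.subset_span hx)
  · obtain ⟨l, -, hlσ⟩ := hstd.isFace i
    rcases hF.eq_zero_or_apply_eq_zero hρ (l := l) (fun x hx => ((hlσ x).1 (hle hx)).2) with
      rfl | h
    · -- here `τᵢ` is the whole cone, so that `bᵢ + ℤ(A ∩ τᵢ) = ℤᵈ`
      obtain ⟨s, hs⟩ := hne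
      have htop : faceGroup A (τ i) = ⊤ := by
        rw [eq_top_iff, ← hA]
        exact AddSubgroup.closure_mono fun c hc => ⟨hc, (hlσ _).2 ⟨toReal_mem_cone hc, rfl⟩⟩
      refine absurd (Set.add_mem_add hs (zero_mem (faceGroup A (τ i))))
        (faceCoset_disjoint_add_faceGroup hstd i ?_)
      rw [htop]
      exact AddSubgroup.mem_top _
    · exact fun x hx => h x ((hlσ x).1 hx).2

/-- For every `a`, the sets `{s ∈ S : a + s ∉ S}` and `{e ∈ T : a + e ∉ T}`, where `T` is the
complement of `-ω(S)`, have the same Zariski closure. -/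
theorem forall_eval_eq_zero_iff_coOmega [CharZero K]
    (hA : AddSubgroup.closure (A : Set (Fin d → ℤ)) = ⊤)
    (hstd : IsStandardExpression A Sc S b τ) (hS : IsNASet A S) (hβ : β ∈ setB K A b τ)
    (p : MvPolynomial (Fin d) K) (a : Fin d → ℤ) :
    (∀ s ∈ S, a + s ∉ S → MvPolynomial.eval (latticeCast K d s) p = 0) ↔
      ∀ e ∈ coOmega A S τ β, a + e ∉ coOmega A S τ β →
        MvPolynomial.eval (latticeCast K d e) p = 0 := by
  refine ⟨fun hp e he hae => eval_eq_zero_of_mem_coOmega hS hβ.1 hp he hae,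
    fun hp s hs has => ?_⟩
  have hSSc : S ⊆ Sc := by
    rw [hstd.eq]
    exact Set.sdiff_subset
  have hbdd : ∀ l : (Fin d → ℝ) →ₗ[ℝ] ℝ, (∀ x ∈ cone A, 0 ≤ l x) →
      ∃ M : ℝ, ∀ s ∈ S, M ≤ l (toReal s) := fun l hl => by
    obtain ⟨M, hM⟩ := hstd.fg.exists_lower_bound hl
    exact ⟨M, fun s hs => hM s (hSSc hs)⟩
  by_cases hSc : a + s ∈ Sc
  · obtain ⟨i, hi⟩ : ∃ i, a + s ∈ faceCoset A (b i) (τ i) := by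
      by_contra! h
      refine has ?_
      rw [hstd.eq]
      exact ⟨hSc, by simpa using h⟩
    refine eval_eq_zero_of_forall_notMem hstd.isFace hβ.1 hbdd hp hs (σ₀ := τ i)
      (Set.mem_union_right _ (Set.mem_range_self i)) fun σ hσ hle z hz => ?_
    obtain ⟨j, rfl, hj⟩ := hβ.2 i σ hσ hle
    refine faceCoset_disjoint_add_faceGroup hstd j ?_
    have hsub : faceGroup A (τ i) ≤ faceGroup A (τ j) :=
      AddSubgroup.closure_mono fun c hc => ⟨hc.1, hle hc.2⟩
    have := add_mem (sub_mem (hsub hi) (hsub hz)) hj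
    convert this using 1
    abel
  · rw [hstd.scored] at hSc
    simp only [Set.mem_ofPred_eq, not_forall] at hSc
    obtain ⟨ρ, F, hρ, hF, hval⟩ := hSc
    refine eval_eq_zero_of_forall_notMem hstd.isFace hβ.1 hbdd hp hs (σ₀ := ρ)
      (Or.inl hρ) fun σ hσ hle z hz => ?_
    rintro ⟨s', hs', z', hz', hsz : s' + z' = a + s + β ρ - z - β σ⟩
    have hFσ := hF.apply_eq_zero_of_le hA hstd ⟨s, hs⟩ hρ hσ hle
    refine hval ⟨s', hSSc hs', ?_⟩
    have h1 := apply_faceGroup_eq_zero hFσ hz'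
    have h2 := apply_faceGroup_eq_zero hF.2.1 hz
    have h3 := apply_faceLattice_eq_zero hF.2.1 (hβ.1 ρ (Or.inl hρ))
    have h4 := apply_faceLattice_eq_zero hFσ (hβ.1 σ hσ)
    have h5 := congrArg (fun y => F (toReal y)) hsz
    simp only [toReal_add, toReal_sub, map_add, map_sub] at h5
    simp only [toReal_add, map_add]
    linarith

/-- A differential operator lies in `D(S)` if and only if its formal adjoint lies in `D(ω(S))`. -/
theorem IsTranspose.mem_D_iff_mem_D_omega [CharZero K]
    (hA : AddSubgroup.closure (A : Set (Fin d → ℤ)) = ⊤)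
    (hstd : IsStandardExpression A Sc S b τ) (hS : IsNASet A S) (hβ : β ∈ setB K A b τ)
    {P Q : Module.End K (Laurent K d)} (hP : P ∈ diffOps K (Laurent K d) (Laurent K d))
    (hPQ : IsTranspose P Q) : P ∈ D K S ↔ Q ∈ D K (omega A S τ β) := by
  obtain ⟨f, hf⟩ := exists_isNormalForm hP
  have hg := isAdjointForm_iff_isNormalForm.1 (hf.isAdjointForm_iff_isTranspose.2 hPQ)
  rw [hf.mem_D_iff, hg.mem_D_iff]
  refine forall_congr' fun a => (forall_eval_eq_zero_iff_coOmega hA hstd hS hβ (f a) a).trans ?_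
  -- the substitution `c = -(a + e)` exchanges the two conditions on `e`
  have hcast : ∀ c : Fin d → ℤ, (fun j => -((a j : K) + (c j : K))) = latticeCast K d (-(a + c)) :=
    fun c => by ext j; simp [latticeCast_apply]
  simp only [eval_adjointCoeffs, mem_omega_iff, not_not, hcast]
  refine ⟨fun h c hc hac => h _ hac ?_, fun h e he hae => ?_⟩
  · rwa [show a + -(a + c) = -c by abel]
  · have := h (-(a + e)) (by rwa [neg_neg]) (by rwa [show -(a + -(a + e)) = e by abel])
    rwa [show -(a + -(a + e)) = e by abel] at this

end CoOmega

/-! ### The anti-isomorphism and its module categories -/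

section AntiIso

variable {K : Type*} [Field K] {d : ℕ}

/-- The ring anti-isomorphism given by transposition, between two rings of operators each of which
consists of the transposes of the operators in the other. -/
def transposeEquiv (R R' : Subalgebra K (Module.End K (Laurent K d)))
    (h : ∀ P ∈ R, ∃ Q ∈ R', IsTranspose P Q) (h' : ∀ Q ∈ R', ∃ P ∈ R, IsTranspose P Q) :
    R ≃+* R'ᵐᵒᵖ where
  toFun P := MulOpposite.op ⟨(h P P.2).choose, (h P P.2).choose_spec.1⟩
  invFun Q := ⟨(h' Q.unop Q.unop.2).choose, (h' Q.unop Q.unop.2).choose_spec.1⟩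
  left_inv P := Subtype.ext <|
    (h' _ (h P P.2).choose_spec.1).choose_spec.2.left_unique (h P P.2).choose_spec.2
  right_inv Q := MulOpposite.unop_injective <| Subtype.ext <|
    (h _ (h' Q.unop Q.unop.2).choose_spec.1).choose_spec.2.right_unique
      (h' Q.unop Q.unop.2).choose_spec.2
  map_mul' P P' := MulOpposite.unop_injective <| Subtype.ext <|
    (h _ (P * P').2).choose_spec.2.right_unique
      ((h P P.2).choose_spec.2.mul (h P' P'.2).choose_spec.2)
  map_add' P P' := MulOpposite.unop_injective <| Subtype.ext <|
    (h _ (P + P').2).choose_spec.2.right_unique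
      ((h P P.2).choose_spec.2.add (h P' P'.2).choose_spec.2)

theorem transposeEquiv_isTranspose {R R' : Subalgebra K (Module.End K (Laurent K d))}
    (h : ∀ P ∈ R, ∃ Q ∈ R', IsTranspose P Q) (h' : ∀ Q ∈ R', ∃ P ∈ R, IsTranspose P Q) (P : R) :
    IsTranspose (P : Module.End K (Laurent K d)) (transposeEquiv R R' h h' P).unop :=
  (h P P.2).choose_spec.2

/-- The formal adjoint is a ring anti-isomorphism from `D(S)` onto `D(ω(S))`. -/
theorem exists_antiIso [CharZero K] {A : Finset (Fin d → ℤ)}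
    (hA : AddSubgroup.closure (A : Set (Fin d → ℤ)) = ⊤) {Sc S : Set (Fin d → ℤ)} {m : ℕ}
    {b : Fin m → Fin d → ℤ} {τ : Fin m → PointedCone ℝ (Fin d → ℝ)}
    (hstd : IsStandardExpression A Sc S b τ) (hS : IsNASet A S)
    {β : PointedCone ℝ (Fin d → ℝ) → Fin d → ℤ} (hβ : β ∈ setB K A b τ) :
    ∃ φ : D K S ≃+* (D K (omega A S τ β))ᵐᵒᵖ, ∀ (P : D K S) (Q : D K (omega A S τ β)),
      IsFormalAdjoint K (P : Module.End K (Laurent K d)) Q ↔ φ P = MulOpposite.op Q := by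
  have h : ∀ P ∈ D K S, ∃ Q ∈ D K (omega A S τ β), IsTranspose P Q := fun P hP => by
    obtain ⟨Q, -, hPQ⟩ := exists_isTranspose hP.1
    exact ⟨Q, (hPQ.mem_D_iff_mem_D_omega hA hstd hS hβ hP.1).1 hP, hPQ⟩
  have h' : ∀ Q ∈ D K (omega A S τ β), ∃ P ∈ D K S, IsTranspose P Q := fun Q hQ => by
    obtain ⟨P, hP, hQP⟩ := exists_isTranspose hQ.1
    exact ⟨P, (hQP.symm.mem_D_iff_mem_D_omega hA hstd hS hβ hP).2 hQ, hQP.symm⟩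
  refine ⟨transposeEquiv _ _ h h', fun P Q => ?_⟩
  have hP := transposeEquiv_isTranspose h h' P
  rw [isFormalAdjoint_iff_isTranspose P.2.1]
  refine ⟨fun hPQ => MulOpposite.unop_injective (Subtype.ext (hP.right_unique hPQ)), fun hPQ => ?_⟩
  rw [hPQ] at hP
  exact hP

/-- Restriction of scalars along a ring isomorphism is an equivalence of module categories that
keeps the underlying abelian groups. -/
theorem exists_moduleCat_equivalence {R R' : Type*} [Ring R] [Ring R'] (φ : R ≃+* R') :
    ∃ (E : ModuleCat.{w} R ≌ ModuleCat.{w} R')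
      (e : E.functor ⋙ forget₂ _ AddCommGrpCat.{w} ≅ forget₂ _ AddCommGrpCat.{w}),
      ∀ (M : ModuleCat.{w} R) (r : R) (x : E.functor.obj M),
        groupIso e M (φ r • x) = r • groupIso e M x := by
  refine ⟨ModuleCat.restrictScalarsEquivalenceOfRingEquiv φ.symm, Iso.refl _, fun M r x => ?_⟩
  have key : ∀ y : M, φ.symm (φ r) • y = r • y := fun y => by rw [φ.symm_apply_apply]
  exact key x

/-- An isomorphism `R ≃ R'ᵐᵒᵖ` matches the left ideals of `R` and the right ideals of `R'`. -/
theorem exists_leftIdeal_orderIso {R R' : Type*} [Ring R] [Ring R'] (φ : R ≃+* R'ᵐᵒᵖ) :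
    ∃ e : Submodule R R ≃o Submodule R'ᵐᵒᵖ R', ∀ I y, y ∈ e I ↔
      ∃ x ∈ I, φ x = MulOpposite.op y := by
  let f : R →ₛₗ[(φ : R →+* R'ᵐᵒᵖ)] R' :=
    { toFun := fun x => (φ x).unop
      map_add' := fun x y => by simp
      map_smul' := fun r x => by simp }
  have := RingHomSurjective.mk (σ := (φ : R →+* R'ᵐᵒᵖ)) φ.surjective
  refine ⟨Submodule.orderIsoMapComapOfBijective f
    (MulOpposite.unop_bijective.comp φ.bijective), fun I y => ?_⟩
  refine exists_congr fun x => and_congr_right fun _ => ?_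
  exact ⟨fun h => MulOpposite.unop_injective h, fun h => congrArg MulOpposite.unop h⟩

/-- An isomorphism `R ≃ R'ᵐᵒᵖ` matches the right ideals of `R` and the left ideals of `R'`. -/
theorem exists_rightIdeal_orderIso {R R' : Type*} [Ring R] [Ring R'] (φ : R ≃+* R'ᵐᵒᵖ) :
    ∃ e : Submodule Rᵐᵒᵖ R ≃o Submodule R' R', ∀ I y, y ∈ e I ↔
      ∃ x ∈ I, φ x = MulOpposite.op y := by
  let ψ : Rᵐᵒᵖ ≃+* R' := (RingEquiv.op φ).trans (RingEquiv.opOp R').symm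
  let f : R →ₛₗ[(ψ : Rᵐᵒᵖ →+* R')] R' :=
    { toFun := fun x => (φ x).unop
      map_add' := fun x y => by simp
      map_smul' := fun r x => by simp [ψ] }
  have := RingHomSurjective.mk (σ := (ψ : Rᵐᵒᵖ →+* R')) ψ.surjective
  refine ⟨Submodule.orderIsoMapComapOfBijective f
    (MulOpposite.unop_bijective.comp φ.bijective), fun I y => ?_⟩
  refine exists_congr fun x => and_congr_right fun _ => ?_
  exact ⟨fun h => MulOpposite.unop_injective h, fun h => congrArg MulOpposite.unop h⟩

/-- The four correspondences attached to a ring isomorphism `R ≃ R'ᵐᵒᵖ` whose graph is `Adj`. -/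
theorem correspondences_of_antiIso {R R' : Type*} [Ring R] [Ring R'] (φ : R ≃+* R'ᵐᵒᵖ)
    {Adj : R → R' → Prop} (hφ : ∀ P Q, Adj P Q ↔ φ P = MulOpposite.op Q) :
    (∃ (E : ModuleCat.{w} R ≌ ModuleCat.{w} R'ᵐᵒᵖ)
        (e : E.functor ⋙ forget₂ _ AddCommGrpCat.{w} ≅ forget₂ _ AddCommGrpCat.{w}),
        ∀ (M : ModuleCat.{w} R) (P : R) (Q : R'), Adj P Q → ∀ x : E.functor.obj M,
          groupIso e M (MulOpposite.op Q • x) = P • groupIso e M x) ∧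
    (∃ e : Submodule R R ≃o Submodule R'ᵐᵒᵖ R', ∀ I Q, Q ∈ e I ↔ ∃ P ∈ I, Adj P Q) ∧
    (∃ (E : ModuleCat.{w} Rᵐᵒᵖ ≌ ModuleCat.{w} R')
        (e : E.functor ⋙ forget₂ _ AddCommGrpCat.{w} ≅ forget₂ _ AddCommGrpCat.{w}),
        ∀ (M : ModuleCat.{w} Rᵐᵒᵖ) (P : R) (Q : R'), Adj P Q → ∀ x : E.functor.obj M,
          groupIso e M (Q • x) = MulOpposite.op P • groupIso e M x) ∧
    (∃ e : Submodule Rᵐᵒᵖ R ≃o Submodule R' R', ∀ I Q, Q ∈ e I ↔ ∃ P ∈ I, Adj P Q) := by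
  let ψ : Rᵐᵒᵖ ≃+* R' := (RingEquiv.op φ).trans (RingEquiv.opOp R').symm
  obtain ⟨E, e, hE⟩ := exists_moduleCat_equivalence.{w} φ
  obtain ⟨E', e', hE'⟩ := exists_moduleCat_equivalence.{w} ψ
  obtain ⟨i, hi⟩ := exists_leftIdeal_orderIso φ
  obtain ⟨i', hi'⟩ := exists_rightIdeal_orderIso φ
  refine ⟨⟨E, e, fun M P Q hPQ x => ?_⟩, ⟨i, fun I Q => ?_⟩, ⟨E', e', fun M P Q hPQ x => ?_⟩,
    ⟨i', fun I Q => ?_⟩⟩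
  · rw [← (hφ P Q).1 hPQ, hE]
  · simp only [hi, hφ]
  · rw [← hE' M (MulOpposite.op P) x, show ψ (MulOpposite.op P) = Q from
      congrArg MulOpposite.unop ((hφ P Q).1 hPQ)]
  · simp only [hi', hφ]

end AntiIso

end ToricDiff

end

theorem mainTheorem4 (K : Type u) [Field K] [IsAlgClosed K] [CharZero K] (d : ℕ)
    (A : Finset (Fin d → ℤ))
    (hA : AddSubgroup.closure (A : Set (Fin d → ℤ)) = ⊤)
    (hcone : (ToricDiff.cone A : ConvexCone ℝ (Fin d → ℝ)).Salient)
    (Sc S : Set (Fin d → ℤ)) (m : ℕ) (b : Fin m → Fin d → ℤ)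
    (τ : Fin m → PointedCone ℝ (Fin d → ℝ))
    (hstd : ToricDiff.IsStandardExpression A Sc S b τ)
    (hS : ToricDiff.IsNASet A S)
    (β : PointedCone ℝ (Fin d → ℝ) → Fin d → ℤ)
    (hβ : β ∈ ToricDiff.setB K A b τ) :
    -- left modules of `D(S)` and right modules of `D(ω(S))`
    (∃ (E : ModuleCat.{w} (ToricDiff.D K S) ≌
          ModuleCat.{w} (ToricDiff.D K (ToricDiff.omega A S τ β))ᵐᵒᵖ)
        (e : E.functor ⋙ forget₂ _ AddCommGrpCat.{w} ≅
          forget₂ _ AddCommGrpCat.{w}),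
        ∀ (M : ModuleCat.{w} (ToricDiff.D K S)) (P : ToricDiff.D K S)
          (Q : ToricDiff.D K (ToricDiff.omega A S τ β)),
          ToricDiff.IsFormalAdjoint K (P : Module.End K (ToricDiff.Laurent K d)) Q →
          ∀ x : E.functor.obj M,
            ToricDiff.groupIso e M (MulOpposite.op Q • x) = P • ToricDiff.groupIso e M x) ∧
    -- left ideals of `D(S)` and right ideals of `D(ω(S))`
    (∃ e : Submodule (ToricDiff.D K S) (ToricDiff.D K S) ≃o
          Submodule (ToricDiff.D K (ToricDiff.omega A S τ β))ᵐᵒᵖ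
            (ToricDiff.D K (ToricDiff.omega A S τ β)),
        ∀ I Q, Q ∈ e I ↔
          ∃ P ∈ I, ToricDiff.IsFormalAdjoint K (P : Module.End K (ToricDiff.Laurent K d)) Q) ∧
    -- right modules of `D(S)` and left modules of `D(ω(S))`
    (∃ (E : ModuleCat.{w} (ToricDiff.D K S)ᵐᵒᵖ ≌
          ModuleCat.{w} (ToricDiff.D K (ToricDiff.omega A S τ β)))
        (e : E.functor ⋙ forget₂ _ AddCommGrpCat.{w} ≅
          forget₂ _ AddCommGrpCat.{w}),
        ∀ (M : ModuleCat.{w} (ToricDiff.D K S)ᵐᵒᵖ) (P : ToricDiff.D K S)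
          (Q : ToricDiff.D K (ToricDiff.omega A S τ β)),
          ToricDiff.IsFormalAdjoint K (P : Module.End K (ToricDiff.Laurent K d)) Q →
          ∀ x : E.functor.obj M,
            ToricDiff.groupIso e M (Q • x) = MulOpposite.op P • ToricDiff.groupIso e M x) ∧
    -- right ideals of `D(S)` and left ideals of `D(ω(S))`
    (∃ e : Submodule (ToricDiff.D K S)ᵐᵒᵖ (ToricDiff.D K S) ≃o
          Submodule (ToricDiff.D K (ToricDiff.omega A S τ β))
            (ToricDiff.D K (ToricDiff.omega A S τ β)),
        ∀ I Q, Q ∈ e I ↔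
          ∃ P ∈ I, ToricDiff.IsFormalAdjoint K (P : Module.End K (ToricDiff.Laurent K d)) Q) := by
  obtain ⟨φ, hφ⟩ := ToricDiff.exists_antiIso hA hstd hS hβ
  exact ToricDiff.correspondences_of_antiIso.{w} (R := ToricDiff.D K S)
    (R' := ToricDiff.D K (ToricDiff.omega A S τ β)) φ hφ
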